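/- Let $q$ be a prime power and $m\ge 1$. A transformation shift register (TSR) of order $n$ over $\mathbb F_{q^m}$ is a linear recurrence $$s_{k+n}=C_0(s_k)+C_1(s_{k+1})+\dots+C_{n-1}(s_{k+n-1})\qquad(k\ge 0)$$ for sequences in $\mathbb F_{q^m}$, where $C_i=c_iA$ for some scalars $c_0,\dots,c_{n-1}\in\mathbb F_q$ and a single $\mathbb F_q$-linear map $A:\mathbb F_{q^m}\to\mathbb F_{q^m}$; two TSRs are equal if their coefficient tuples $(C_0,\dots,C_{n-1})$ are equal. It is called irreducible if the characteristic polynomial over $\mathbb F_q$ of its state transition map $$(s_0,\dots,s_{n-1})\mapsto\bigl(s_1,\dots,s_{n-1},\,C_0(s_0)+\dots+C_{n-1}(s_{n-1})\bigr)$$ on $(\mathbb F_{q^m})^n$ is irreducible. Let $\mathrm{TSRI}(m,n,q)$ be the set of irreducible TSRs of order $n$ over $\mathbb F_{q^m}$, let $\mu$ be the Möbius function, and let $\varepsilon=\left(\frac q3\right)$ be the Legendre symbol. If $q$ is not a power of three, then $$|\mathrm{TSRI}(m,3,q)|=\frac{q\,|\mathrm{GL}_m(\mathbb F_q)|}{3m(q^m-1)}\sum_{d\mid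 m,\ 3\nmid d}\mu(d)\bigl(q+\varepsilon^{m/d}\bigr)\bigl(q^{m/d}-\varepsilon^{m/d}\bigr).$$ If $q$ is a power of three, then $$|\mathrm{TSRI}(m,3,q)|=\frac{(q-1)\,|\mathrm{GL}_m(\mathbb F_q)|}{3m(q^m-1)}\sum_{d\mid m,\ 3\nmid d}\mu(d)\left(q+\frac{3+(-1)^{m/d}}2\right)q^{m/d}.$$ -/

import Mathlib

/-!
Transformation shift registers (TSRs) over a finite extension `E` of a finite field `K`.
-/

noncomputable section

/-- The tuple `C = (C_0, …, C_{n-1})` of `K`-linear maps `E → E` is the tuple of feedback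
coefficients of a transformation shift register of order `n`: there are scalars
`c_0, …, c_{n-1}` in `K` and a single `K`-linear transformation `A` of `E` with `C_i = c_i A`.
The register generates the sequences `s` in `E` with
`s_{k+n} = c_0 A(s_k) + c_1 A(s_{k+1}) + … + c_{n-1} A(s_{k+n-1})`. -/
def IsTSR (K E : Type*) [Field K] [AddCommGroup E] [Module K E] (n : ℕ)
    (C : Fin n → Module.End K E) : Prop :=
  ∃ (c : Fin n → K) (A : Module.End K E), ∀ i, C i = c i • A

/-- The state transition map of the shift register with feedback coefficients `C`:
`(s_0, …, s_{n-1}) ↦ (s_1, …, s_{n-1}, C_0 s_0 + ⋯ + C_{n-1} s_{n-1})`.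
In a `K`-basis of `E` it is given by a block companion matrix. -/
def tsrTransition (K E : Type*) [Field K] [AddCommGroup E] [Module K E] (n : ℕ)
    (C : Fin n → Module.End K E) : Module.End K (Fin n → E) :=
  LinearMap.pi fun i : Fin n =>
    if h : (i : ℕ) + 1 < n then LinearMap.proj (⟨(i : ℕ) + 1, h⟩ : Fin n)
    else ∑ j : Fin n, C j ∘ₗ LinearMap.proj j

/-- The set of irreducible transformation shift registers of order `n` over `E`: those whose
state transition map has an irreducible characteristic polynomial over `K`.
A register is identified with its recurrence, that is, with the tuple `C`. -/
def TSRI (K E : Type*) [Field K] [AddCommGroup E] [Module K E] [FiniteDimensional K E] (n : ℕ) :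
    Set (Fin n → Module.End K E) :=
  {C | IsTSR K E n C ∧ Irreducible (LinearMap.charpoly (tsrTransition K E n C))}

end

/-!
A register with coefficients `c_i A` and irreducible characteristic polynomial has `c_0 ≠ 0`, so it
can be written uniquely with coefficients `(A, bA, aA)`. If `W` is an invariant subspace of `A`,
then `W³` is an invariant subspace of the register; hence `A` has no nontrivial invariant subspace,
and `A = φ ∘ (α ·) ∘ φ⁻¹` for a generator `α` of `L` over `K` and a `K`-linear automorphism `φ`
of `L`. Each `A` arises from `m (q ^ m - 1)` pairs `(φ, α)`: one for each root `α` of its minimal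
polynomial and each nonzero value of `φ` at `1` (`card_mul_card_missedGenerators`).

For multiplication by `α` the register is the companion map over `L` of the cubic
`X³ - α (1 + bX + aX²)`. Since a root `x` of this cubic generates `α` over `K`, the register is
irreducible over `K` exactly when the cubic is irreducible over `L`. After `Y = 1 / X` this says
that the polynomial `Y³ + bY² + aY` does not take the value `α⁻¹` on `L`
(`irreducible_charpoly_mulLeft_iff`). So the problem is to count the triples of `b, a ∈ K` and a
generator of `L` that `Y³ + bY² + aY` misses.

The restriction to generators is removed by Möbius inversion over the subfields of `L`
(`sum_card_missedGenerators`). A value in a subfield `F` missed over `F` stays missed over `L` if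
and only if `3 ∤ [L : F]`, which is where the condition `3 ∤ d` comes from.

Over a single finite field, three times the number of values missed by a cubic `h` is the number of
zeros `(y, z)` of its divided difference `(h(y) - h(z)) / (y - z)`, minus the number of triple
roots (`three_mul_card_missedValues`). Away from characteristic three, completing the cube turns the
divided difference into `y² + yz + z²` minus a constant, whose zeros are counted by the norm form of
the cube roots of unity; the Legendre symbol records whether these lie in the field. In
characteristic three the divided difference is `(y - z)² + b(y + z) + a`, and the remaining count is
that of the square roots in the field of elements of `K`.
-/

/-! ### Values missed by a cubic polynomial over a finite field -/

/-- The value at `y` of the monic cubic polynomial `Y³ + bY² + aY`. -/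
def cubicVal {F : Type*} [Field F] (b a y : F) : F := y ^ 3 + b * y ^ 2 + a * y

/-- The divided difference `(h(y) - h(z)) / (y - z)` of `h = Y³ + bY² + aY`, as a polynomial
in `y` and `z`. -/
def cubicDiff {F : Type*} [Field F] (b a y z : F) : F := y ^ 2 + y * z + z ^ 2 + b * (y + z) + a

section Missed

variable {F : Type*} [Fintype F] [DecidableEq F]

/-- If `y, z, w` are the roots of a cubic, the pairs on the right are the zeros of its divided
difference in the fibre. The proof distinguishes the coincidences among the roots. -/
theorem card_fiber_of_splits (y z w : F) :
    (({p : F | p = y ∧ y = z ∧ z = w} : Finset F)).card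
      + 3 * ({p : F | p = y ∨ p = z ∨ p = w} : Finset F).card
    = ({p : F × F | (p.1 = y ∧ (p.2 = z ∨ p.2 = w)) ∨ (p.1 = z ∧ (p.2 = y ∨ p.2 = w)) ∨
        (p.1 = w ∧ (p.2 = y ∨ p.2 = z))} : Finset (F × F)).card + 3 := by
  have h1 : ({p : F | p = y ∨ p = z ∨ p = w} : Finset F) = {y, z, w} := by
    ext p; simp
  have h2 : ({p : F × F | (p.1 = y ∧ (p.2 = z ∨ p.2 = w)) ∨ (p.1 = z ∧ (p.2 = y ∨ p.2 = w)) ∨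
        (p.1 = w ∧ (p.2 = y ∨ p.2 = z))} : Finset (F × F))
      = {(y, z), (y, w), (z, y), (z, w), (w, y), (w, z)} := by
    ext ⟨p, r⟩
    simp only [Finset.mem_filter, Finset.mem_univ, true_and, Finset.mem_insert,
      Finset.mem_singleton, Prod.mk.injEq]
    tauto
  rw [h1, h2]
  by_cases a1 : y = z
  · subst a1
    by_cases a2 : y = w
    · subst a2
      simp [Finset.filter_eq']
    · have : ({p : F | p = y ∧ y = y ∧ y = w} : Finset F) = ∅ := by
        ext; simp [a2]
      rw [this]
      have h3 : (({(y, y), (y, w), (y, y), (y, w), (w, y), (w, y)} : Finset (F × F))).card = 3 := by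
        have : ({(y, y), (y, w), (y, y), (y, w), (w, y), (w, y)} : Finset (F × F))
            = {(y, y), (y, w), (w, y)} := by
          ext p; simp only [Finset.mem_insert, Finset.mem_singleton]; tauto
        rw [this]
        exact Finset.card_eq_three.2 ⟨_, _, _, by simp [a2], by simp [a2], by simp [a2], rfl⟩
      rw [h3]
      simp [Finset.card_pair a2]
  · have : ({p : F | p = y ∧ y = z ∧ z = w} : Finset F) = ∅ := by
      ext; simp [a1]
    rw [this]
    have a1' := Ne.symm a1
    by_cases a2 : y = w
    · subst a2
      have h3 : (({(y, z), (y, y), (z, y), (z, y), (y, y), (y, z)} : Finset (F × F))).card = 3 := by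
        have : ({(y, z), (y, y), (z, y), (z, y), (y, y), (y, z)} : Finset (F × F))
            = {(y, z), (y, y), (z, y)} := by
          ext p; simp only [Finset.mem_insert, Finset.mem_singleton]; tauto
        rw [this]
        exact Finset.card_eq_three.2 ⟨_, _, _, by simp [a1'], by simp [a1], by simp [a1], rfl⟩
      have h4 : ({y, z, y} : Finset F) = {y, z} := by
        ext p; simp only [Finset.mem_insert, Finset.mem_singleton]; tauto
      rw [h3, h4]
      simp [Finset.card_pair a1]
    · have a2' := Ne.symm a2
      by_cases a3 : z = w
      · subst a3
        have h3 : (({(y, z), (y, z), (z, y), (z, z), (z, y), (z, z)} : Finset (F × F))).card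
            = 3 := by
          have : ({(y, z), (y, z), (z, y), (z, z), (z, y), (z, z)} : Finset (F × F))
              = {(y, z), (z, y), (z, z)} := by
            ext p; simp only [Finset.mem_insert, Finset.mem_singleton]; tauto
          rw [this]
          exact Finset.card_eq_three.2 ⟨_, _, _, by simp [a1], by simp [a1], by simp [a1], rfl⟩
        rw [h3]
        simp [Finset.card_pair a1]
      · have a3' := Ne.symm a3
        have h4 : ({y, z, w} : Finset F).card = 3 :=
          Finset.card_eq_three.2 ⟨_, _, _, a1, a2, a3, rfl⟩
        rw [h4]
        repeat rw [Finset.card_insert_of_notMem]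
        all_goals simp [a1, a2, a3, a1', a2', a3']

variable [Field F]

/-- The elements of `F` that are not values of `Y³ + bY² + aY` on `F`. -/
def missedValues (b a : F) : Finset F := {β | ∀ y, cubicVal b a y ≠ β}

theorem mem_missedValues {b a β : F} : β ∈ missedValues b a ↔ ∀ y, cubicVal b a y ≠ β := by
  simp [missedValues]

/-- In the fibre of the cubic over `β`, the number of zeros of the divided difference is
determined by the number of roots, up to a correction at triple roots. -/
theorem card_fiber_cubicDiff (b a β : F) :
    (if β ∈ missedValues b a then 3 else 0)
      + ({y : F | (b = -3 * y ∧ a = 3 * y ^ 2) ∧ cubicVal b a y = β} : Finset F).card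
      + 3 * ({y : F | cubicVal b a y = β} : Finset F).card
    = ({p : F × F | cubicDiff b a p.1 p.2 = 0 ∧ cubicVal b a p.1 = β} : Finset (F × F)).card
      + 3 := by
  by_cases hm : β ∈ missedValues b a
  · have := mem_missedValues.1 hm
    simp [hm, this]
  · rw [if_neg hm, zero_add]
    rw [mem_missedValues] at hm
    push Not at hm
    obtain ⟨y, hy⟩ := hm
    by_cases hz : ∃ z, cubicDiff b a y z = 0
    · obtain ⟨z, hz⟩ := hz
      -- The third root comes from the coefficient of `Y²`.
      obtain ⟨w, hw⟩ : ∃ w, w = -b - y - z := ⟨_, rfl⟩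
      have hb : b = -(y + z + w) := by rw [hw]; ring
      have ha : a = y * z + y * w + z * w := by
        unfold cubicDiff at hz
        rw [hb] at hz
        linear_combination hz
      have hβ : β = y * z * w := by
        rw [← hy, cubicVal, ha, hb]; ring
      have e1 : ∀ p, cubicVal b a p = β ↔ p = y ∨ p = z ∨ p = w := by
        intro p
        have : cubicVal b a p - β = (p - y) * ((p - z) * (p - w)) := by
          rw [cubicVal, hβ, ha, hb]; ring
        rw [← sub_eq_zero, this]
        simp [sub_eq_zero]
      have f1 : ∀ r, cubicDiff b a y r = 0 ↔ r = z ∨ r = w := by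
        intro r
        have : cubicDiff b a y r = (r - z) * (r - w) := by
          rw [cubicDiff, ha, hb]; ring
        rw [this]; simp [sub_eq_zero]
      have f2 : ∀ r, cubicDiff b a z r = 0 ↔ r = y ∨ r = w := by
        intro r
        have : cubicDiff b a z r = (r - y) * (r - w) := by
          rw [cubicDiff, ha, hb]; ring
        rw [this]; simp [sub_eq_zero]
      have f3 : ∀ r, cubicDiff b a w r = 0 ↔ r = y ∨ r = z := by
        intro r
        have : cubicDiff b a w r = (r - y) * (r - z) := by
          rw [cubicDiff, ha, hb]; ring
        rw [this]; simp [sub_eq_zero]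
      have key := card_fiber_of_splits y z w
      have g1 : ({p : F | (b = -3 * p ∧ a = 3 * p ^ 2) ∧ cubicVal b a p = β} : Finset F)
          = ({p : F | p = y ∧ y = z ∧ z = w} : Finset F) := by
        ext p
        simp only [Finset.mem_filter, Finset.mem_univ, true_and]
        constructor
        · rintro ⟨⟨h1, h2⟩, h3⟩
          have hp : ∀ r, cubicVal b a r = β → r = p := by
            intro r hr
            have : (r - p) ^ 3 = 0 := by
              have : cubicVal b a r = cubicVal b a p := hr.trans h3.symm
              rw [cubicVal, cubicVal, h1, h2] at this
              linear_combination this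
            exact sub_eq_zero.1 (pow_eq_zero_iff (by norm_num) |>.1 this)
          have r1 := hp y ((e1 y).2 (by simp))
          have r2 := hp z ((e1 z).2 (by simp))
          have r3 := hp w ((e1 w).2 (by simp))
          exact ⟨r1.symm, r1.trans r2.symm, r2.trans r3.symm⟩
        · rintro ⟨h1, h2, h3⟩
          refine ⟨⟨?_, ?_⟩, (e1 p).2 (Or.inl h1)⟩
          · rw [hb, h1, ← h3, ← h2]; ring
          · rw [ha, h1, ← h3, ← h2]; ring
      have g2 : ({p : F | cubicVal b a p = β} : Finset F)
          = ({p : F | p = y ∨ p = z ∨ p = w} : Finset F) := by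
        ext p; simp [e1]
      have g3 : ({p : F × F | cubicDiff b a p.1 p.2 = 0 ∧ cubicVal b a p.1 = β} :
          Finset (F × F)) = ({p : F × F | (p.1 = y ∧ (p.2 = z ∨ p.2 = w)) ∨
            (p.1 = z ∧ (p.2 = y ∨ p.2 = w)) ∨ (p.1 = w ∧ (p.2 = y ∨ p.2 = z))} :
              Finset (F × F)) := by
        ext ⟨p, r⟩
        simp only [Finset.mem_filter, Finset.mem_univ, true_and]
        rw [e1]
        constructor
        · rintro ⟨h1, h2 | h2 | h2⟩
          · subst h2; exact Or.inl ⟨rfl, (f1 _).1 h1⟩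
          · subst h2; exact Or.inr (Or.inl ⟨rfl, (f2 _).1 h1⟩)
          · subst h2; exact Or.inr (Or.inr ⟨rfl, (f3 _).1 h1⟩)
        · rintro (⟨h1, h2⟩ | ⟨h1, h2⟩ | ⟨h1, h2⟩)
          · subst h1; exact ⟨(f1 _).2 h2, Or.inl rfl⟩
          · subst h1; exact ⟨(f2 _).2 h2, Or.inr (Or.inl rfl)⟩
          · subst h1; exact ⟨(f3 _).2 h2, Or.inr (Or.inr rfl)⟩
      rw [g1, g2, g3]
      exact key
    · push Not at hz
      have e1 : ∀ p, cubicVal b a p = β → p = y := by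
        intro p hp
        by_contra hne
        refine hz p ?_
        have : (y - p) * cubicDiff b a y p = 0 := by
          have h : cubicVal b a y = cubicVal b a p := hy.trans hp.symm
          rw [cubicVal, cubicVal] at h
          rw [cubicDiff]
          linear_combination h
        rcases mul_eq_zero.1 this with h | h
        · exact absurd (sub_eq_zero.1 h).symm hne
        · exact h
      have g1 : ({p : F | (b = -3 * p ∧ a = 3 * p ^ 2) ∧ cubicVal b a p = β} : Finset F) = ∅ := by
        ext p
        simp only [Finset.mem_filter, Finset.mem_univ, true_and, Finset.notMem_empty, iff_false]
        rintro ⟨⟨h1, h2⟩, h3⟩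
        have := e1 p h3
        subst this
        refine hz p ?_
        rw [cubicDiff, h1, h2]; ring
      have g2 : ({p : F | cubicVal b a p = β} : Finset F) = {y} := by
        ext p
        simp only [Finset.mem_filter, Finset.mem_univ, true_and, Finset.mem_singleton]
        exact ⟨e1 p, fun h => h ▸ hy⟩
      have g3 : ({p : F × F | cubicDiff b a p.1 p.2 = 0 ∧ cubicVal b a p.1 = β} :
          Finset (F × F)) = ∅ := by
        ext ⟨p, r⟩
        simp only [Finset.mem_filter, Finset.mem_univ, true_and, Finset.notMem_empty, iff_false]
        rintro ⟨h1, h2⟩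
        rw [e1 p h2] at h1
        exact hz r h1
      rw [g1, g2, g3]
      simp

/-- Three times the number of missed values is the number of zeros of the divided difference,
minus the number of triple roots of the polynomials `h - β`. -/
theorem three_mul_card_missedValues (b a : F) :
    3 * (missedValues b a).card + ({y : F | b = -3 * y ∧ a = 3 * y ^ 2} : Finset F).card
      = ({p : F × F | cubicDiff b a p.1 p.2 = 0} : Finset (F × F)).card := by
  have s := Finset.sum_congr rfl fun β (_ : β ∈ (Finset.univ : Finset F)) =>
    card_fiber_cubicDiff b a β
  simp only [Finset.sum_add_distrib, ← Finset.mul_sum] at s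
  have t1 : ∑ β : F, ({y : F | (b = -3 * y ∧ a = 3 * y ^ 2) ∧ cubicVal b a y = β} :
      Finset F).card = ({y : F | b = -3 * y ∧ a = 3 * y ^ 2} : Finset F).card := by
    rw [Finset.card_eq_sum_card_fiberwise (f := cubicVal b a) (t := Finset.univ) (by simp)]
    simp only [Finset.filter_filter]
  have t2 : ∑ β : F, ({y : F | cubicVal b a y = β} : Finset F).card = Fintype.card F := by
    rw [← Finset.card_univ,
      Finset.card_eq_sum_card_fiberwise (f := cubicVal b a) (t := Finset.univ) (by simp)]
  have t3 : ∑ β : F, ({p : F × F | cubicDiff b a p.1 p.2 = 0 ∧ cubicVal b a p.1 = β} :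
      Finset (F × F)).card = ({p : F × F | cubicDiff b a p.1 p.2 = 0} : Finset (F × F)).card := by
    rw [Finset.card_eq_sum_card_fiberwise (f := fun p : F × F => cubicVal b a p.1)
      (t := Finset.univ) (by simp)]
    simp only [Finset.filter_filter]
  rw [t1, t2, t3] at s
  rw [← Finset.sum_filter] at s
  simp only [Finset.sum_const, Finset.card_univ, smul_eq_mul] at s
  have : ({β | β ∈ missedValues b a} : Finset F) = missedValues b a := by ext; simp
  rw [this] at s
  omega

end Missed

/-! ### The quadratic form `y² + yz + z²` over a finite field -/

section NormForm

variable {F : Type*} [Field F] [Fintype F]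

theorem three_dvd_card_iff : 3 ∣ Fintype.card F ↔ (3 : F) = 0 := by
  obtain ⟨p, hp, n, hpp, hcard⟩ := FiniteField.card' F
  constructor
  · intro h
    rw [hcard] at h
    have := (Nat.prime_dvd_prime_iff_eq Nat.prime_three hpp).1 (Nat.prime_three.dvd_of_dvd_pow h)
    subst this
    exact_mod_cast CharP.cast_eq_zero F 3
  · intro h
    have h' : ((3 : ℕ) : F) = 0 := by exact_mod_cast h
    have := (CharP.cast_eq_zero_iff F p 3).1 h'
    rw [hcard, (Nat.prime_dvd_prime_iff_eq hpp Nat.prime_three).1 this]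
    exact dvd_pow_self _ n.pos.ne'

open Polynomial in
/-- The form `y² + yz + z²` represents every element of a finite field whose characteristic
is not three. -/
theorem exists_eisenstein_eq (h3 : (3 : F) ≠ 0) (c : F) : ∃ y z : F, y ^ 2 + y * z + z ^ 2 = c := by
  by_cases h2 : ringChar F = 2
  · obtain ⟨r, hr⟩ := FiniteField.isSquare_of_char_two h2 c
    exact ⟨r, 0, by rw [hr]; ring⟩
  -- Complete the square: `4 (y² + yz + z²) = (2y + z)² + 3z²`.
  · have h2' : (2 : F) ≠ 0 := Ring.two_ne_zero h2
    obtain ⟨s, z, h⟩ := FiniteField.exists_root_sum_quadratic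
      (f := (C 1 * X ^ 2 + C 0 * X + C (-4 * c) : F[X])) (g := C 3 * X ^ 2 + C 0 * X + C 0)
      (degree_quadratic one_ne_zero) (degree_quadratic h3)
      (FiniteField.odd_card_of_char_ne_two h2)
    simp only [eval_add, eval_mul, eval_C, eval_pow, eval_X] at h
    refine ⟨(s - z) / 2, z, ?_⟩
    field_simp
    linear_combination h

variable [DecidableEq F]

/-- The number of representations of `c` by the quadratic form `y² + yz + z²`. -/
def eisensteinCount (c : F) : ℕ :=
  ({p : F × F | p.1 ^ 2 + p.1 * p.2 + p.2 ^ 2 = c} : Finset (F × F)).card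

/-- The number of roots of `t² + t + 1` in `F`. They are the primitive cube roots of unity when
`3 ≠ 0` in `F`. -/
def omegaCount (F : Type*) [Field F] [Fintype F] [DecidableEq F] : ℕ :=
  ({t : F | t ^ 2 + t + 1 = 0} : Finset F).card

/-- A zero `(y, z)` with `z ≠ 0` has `y / z` a primitive cube root of unity. -/
theorem eisensteinCount_zero :
    eisensteinCount (0 : F) = 1 + omegaCount F * (Fintype.card F - 1) := by
  unfold eisensteinCount
  rw [Finset.card_eq_sum_card_fiberwise (f := fun p : F × F => p.2) (t := Finset.univ) (by simp)]
  rw [← Finset.add_sum_erase _ _ (Finset.mem_univ (0 : F))]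
  congr 1
  · rw [Finset.card_eq_one]
    refine ⟨(0, 0), ?_⟩
    ext ⟨y, z⟩
    simp only [Finset.mem_filter, Finset.mem_univ, true_and, Finset.mem_singleton, Prod.mk.injEq]
    constructor
    · rintro ⟨h, rfl⟩
      simpa using h
    · rintro ⟨rfl, rfl⟩
      simp
  · rw [Finset.sum_const_nat (m := omegaCount F), Finset.card_erase_of_mem (Finset.mem_univ _),
      Finset.card_univ, mul_comm]
    intro z hz
    have hz : z ≠ 0 := Finset.ne_of_mem_erase hz
    symm
    refine Finset.card_bij (fun t _ => (t * z, z)) ?_ ?_ ?_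
    · intro t ht
      simp only [Finset.mem_filter, Finset.mem_univ, true_and] at ht ⊢
      exact ⟨by linear_combination z ^ 2 * ht, trivial⟩
    · intro t _ s _ h
      simp only [Prod.mk.injEq, and_true] at h
      exact mul_right_cancel₀ hz h
    · rintro ⟨y, z'⟩ h
      simp only [Finset.mem_filter, Finset.mem_univ, true_and] at h
      obtain ⟨h, rfl⟩ := h
      refine ⟨y / z', ?_, by simp [hz]⟩
      simp only [Finset.mem_filter, Finset.mem_univ, true_and]
      field_simp
      linear_combination h

/-- Multiplication by an element of norm `c'` shows that passing from `c` to `c * c'` does not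
decrease the number of representations. -/
theorem eisensteinCount_le_mul (h3 : (3 : F) ≠ 0) (c : F) {c' : F} (hc' : c' ≠ 0) :
    eisensteinCount c ≤ eisensteinCount (c * c') := by
  obtain ⟨y, z, h⟩ := exists_eisenstein_eq h3 c'
  refine Finset.card_le_card_of_injOn
    (fun p => (p.1 * y - p.2 * z, p.1 * z + p.2 * y + p.2 * z)) ?_ ?_
  · rintro ⟨u, v⟩ hu
    simp only [Finset.mem_coe, Finset.mem_filter, Finset.mem_univ, true_and] at hu ⊢
    rw [← hu, ← h]; ring
  · rintro ⟨u, v⟩ - ⟨u', v'⟩ - huv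
    simp only [Prod.mk.injEq] at huv
    obtain ⟨e1, e2⟩ := huv
    rw [← h] at hc'
    refine Prod.ext (mul_right_cancel₀ hc' ?_) (mul_right_cancel₀ hc' ?_)
    · linear_combination (y + z) * e1 + z * e2
    · linear_combination y * e2 - z * e1

theorem eisensteinCount_eq_one (h3 : (3 : F) ≠ 0) {c : F} (hc : c ≠ 0) :
    eisensteinCount c = eisensteinCount (1 : F) := by
  apply le_antisymm
  · have := eisensteinCount_le_mul h3 c (inv_ne_zero hc)
    rwa [mul_inv_cancel₀ hc] at this
  · have := eisensteinCount_le_mul h3 1 hc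
    rwa [one_mul] at this

/-- Nonzero elements are represented equally often, so their count follows from that of `0`. -/
theorem eisensteinCount_of_ne_zero (h3 : (3 : F) ≠ 0) {c : F} (hc : c ≠ 0) :
    (eisensteinCount c : ℤ) = Fintype.card F + 1 - omegaCount F := by
  have hs : ∑ c : F, eisensteinCount c = Fintype.card F * Fintype.card F := by
    rw [← Fintype.card_prod, ← Finset.card_univ]
    exact (Finset.card_eq_sum_card_fiberwise
      (f := fun p : F × F => p.1 ^ 2 + p.1 * p.2 + p.2 ^ 2) (t := Finset.univ) (by simp)).symm
  rw [← Finset.add_sum_erase _ _ (Finset.mem_univ (0 : F)), eisensteinCount_zero,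
    Finset.sum_const_nat (m := eisensteinCount c), Finset.card_erase_of_mem (Finset.mem_univ _),
    Finset.card_univ] at hs
  · have hQ : 1 < Fintype.card F := Fintype.one_lt_card
    have hs' : (1 + omegaCount F * ((Fintype.card F : ℤ) - 1))
        + ((Fintype.card F : ℤ) - 1) * eisensteinCount c = Fintype.card F * Fintype.card F := by
      rw [← Nat.cast_one, ← Nat.cast_sub hQ.le]
      exact_mod_cast hs
    have hne : (Fintype.card F : ℤ) - 1 ≠ 0 := by
      have : (1 : ℤ) < Fintype.card F := by exact_mod_cast hQ
      omega
    apply mul_left_cancel₀ hne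
    linear_combination hs'
  · intro x hx
    rw [eisensteinCount_eq_one h3 (Finset.ne_of_mem_erase hx), eisensteinCount_eq_one h3 hc]

theorem omegaCount_of_dvd (h3 : (3 : F) ≠ 0) (h : 3 ∣ Fintype.card F - 1) : omegaCount F = 2 := by
  rw [← Fintype.card_units] at h
  have : Fact (Nat.Prime 3) := ⟨Nat.prime_three⟩
  obtain ⟨u, hu⟩ := exists_prime_orderOf_dvd_card 3 h
  have hu3 : (u : F) ^ 3 = 1 := by
    rw [← Units.val_pow_eq_pow_val, ← hu, pow_orderOf_eq_one, Units.val_one]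
  have hu1 : (u : F) ≠ 1 := by
    intro h1
    rw [Units.val_eq_one.1 h1, orderOf_one] at hu
    omega
  have ht : (u : F) ^ 2 + u + 1 = 0 := by
    apply mul_left_cancel₀ (sub_ne_zero.2 hu1)
    linear_combination hu3
  have hne : (u : F) ≠ -1 - u := by
    intro h
    apply h3
    linear_combination 4 * ht - (2 * (u : F) + 1) * h
  unfold omegaCount
  rw [show ({t : F | t ^ 2 + t + 1 = 0} : Finset F) = {(u : F), -1 - (u : F)} from ?_,
    Finset.card_pair hne]
  ext t
  simp only [Finset.mem_filter, Finset.mem_univ, true_and, Finset.mem_insert,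
    Finset.mem_singleton]
  have : t ^ 2 + t + 1 = (t - u) * (t - (-1 - u)) := by linear_combination ht
  rw [this, mul_eq_zero, sub_eq_zero, sub_eq_zero]

theorem omegaCount_of_not_dvd (h3 : (3 : F) ≠ 0) (h : ¬ 3 ∣ Fintype.card F - 1) :
    omegaCount F = 0 := by
  unfold omegaCount
  rw [Finset.card_eq_zero, Finset.filter_eq_empty_iff]
  intro t _ ht
  apply h
  have ht3 : t ^ 3 = 1 := by linear_combination (t - 1) * ht
  have ht0 : t ≠ 0 := by rintro rfl; simp at ht
  have ht1 : t ≠ 1 := by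
    rintro rfl
    apply h3
    linear_combination ht
  have : Fact (Nat.Prime 3) := ⟨Nat.prime_three⟩
  have ho : orderOf (Units.mk0 t ht0) = 3 := by
    apply orderOf_eq_prime
    · ext; simpa using ht3
    · intro h1
      exact ht1 (by simpa using congrArg Units.val h1)
  rw [← Fintype.card_units, ← ho]
  exact orderOf_dvd_card

/-- Over the field with `q ^ k` elements, `1 + (q / 3) ^ k` counts the primitive cube roots
of unity. -/
theorem omegaCount_eq_legendreSym (h3 : (3 : F) ≠ 0) {q k : ℕ} (hk : k ≠ 0)
    (hF : Fintype.card F = q ^ k) : (omegaCount F : ℤ) = 1 + legendreSym 3 q ^ k := by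
  have hq : ¬ 3 ∣ q := fun h => h3 (three_dvd_card_iff.1 (hF ▸ dvd_pow h hk))
  have hpos : 0 < Fintype.card F := Fintype.card_pos
  rw [legendreSym.mod]
  have hmod : Fintype.card F % 3 = (q % 3) ^ k % 3 := by rw [hF, Nat.pow_mod]
  have hq' : q % 3 = 1 ∨ q % 3 = 2 := by omega
  rcases hq' with h | h
  · have e : ((q : ℤ) % (3 : ℕ)) = 1 := by omega
    rw [h, one_pow] at hmod
    rw [omegaCount_of_dvd h3 (by omega), e, legendreSym.at_one]
    norm_num
  · have e : ((q : ℤ) % (3 : ℕ)) = 2 := by omega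
    have e2 : legendreSym 3 2 = -1 := by decide
    rw [e, e2]
    rcases Nat.even_or_odd k with hk' | hk'
    · have : 2 ^ k % 3 = 1 := by
        obtain ⟨j, rfl⟩ := hk'
        rw [← two_mul, pow_mul, Nat.pow_mod]; simp
      rw [h, this] at hmod
      rw [omegaCount_of_dvd h3 (by omega), hk'.neg_one_pow]
      norm_num
    · have : 2 ^ k % 3 = 2 := by
        obtain ⟨j, rfl⟩ := hk'
        rw [pow_succ, pow_mul, Nat.mul_mod, Nat.pow_mod]; simp
      rw [h, this] at hmod
      rw [omegaCount_of_not_dvd h3 (by omega), hk'.neg_one_pow]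
      norm_num

end NormForm

/-! ### Missed values summed over the cubics with coefficients in a subfield -/

section Sum

theorem mem_range_algebraMap_iff_pow_card {K F : Type*} [Field K] [Fintype K] [Field F]
    [Algebra K F] (x : F) :
    (∃ c : K, algebraMap K F c = x) ↔ x ^ Fintype.card K = x := by
  classical
  constructor
  · rintro ⟨c, rfl⟩
    rw [← map_pow, FiniteField.pow_card]
  · intro h
    have hp : Polynomial.X ^ Fintype.card K - Polynomial.X ≠ (0 : Polynomial F) :=
      FiniteField.X_pow_card_sub_X_ne_zero F Fintype.one_lt_card
    have hs : Finset.univ.image (algebraMap K F) ⊆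
        (Polynomial.X ^ Fintype.card K - Polynomial.X : Polynomial F).roots.toFinset := by
      intro y hy
      obtain ⟨c, -, rfl⟩ := Finset.mem_image.1 hy
      rw [Multiset.mem_toFinset, Polynomial.mem_roots hp]
      simp [← map_pow, FiniteField.pow_card]
    have he := Finset.eq_of_subset_of_card_le hs (by
      rw [Finset.card_image_of_injective _ (algebraMap K F).injective, Finset.card_univ]
      refine (Multiset.toFinset_card_le _).trans ((Polynomial.card_roots' _).trans ?_)
      rw [FiniteField.X_pow_card_sub_X_natDegree_eq F Fintype.one_lt_card])
    have hx : x ∈ Finset.univ.image (algebraMap K F) := by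
      rw [he, Multiset.mem_toFinset, Polynomial.mem_roots hp]
      simp [h]
    obtain ⟨c, -, hc⟩ := Finset.mem_image.1 hx
    exact ⟨c, hc⟩

variable {K F : Type*} [Field K] [Fintype K] [Field F] [Fintype F] [DecidableEq F] [Algebra K F]

/-- The total number of values in `F` missed by the cubics `Y³ + bY² + aY` with `a, b ∈ K`. -/
def totalMissed (K F : Type*) [Field K] [Fintype K] [Field F] [Fintype F] [DecidableEq F]
    [Algebra K F] : ℕ :=
  ∑ b : K, ∑ a : K, (missedValues (algebraMap K F b) (algebraMap K F a)).card

theorem three_mul_totalMissed :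
    3 * totalMissed K F + ∑ b : K, ∑ a : K, ({y : F | algebraMap K F b = -3 * y ∧
        algebraMap K F a = 3 * y ^ 2} : Finset F).card
      = ∑ b : K, ∑ a : K, ({p : F × F | cubicDiff (algebraMap K F b) (algebraMap K F a)
          p.1 p.2 = 0} : Finset (F × F)).card := by
  unfold totalMissed
  simp only [Finset.mul_sum, ← Finset.sum_add_distrib, three_mul_card_missedValues]

/-- Completing the cube turns the divided difference into the form `y² + yz + z²`. -/
theorem card_cubicDiff_eq_eisensteinCount (h3 : (3 : F) ≠ 0) (b a : F) :
    ({p : F × F | cubicDiff b a p.1 p.2 = 0} : Finset (F × F)).card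
      = eisensteinCount (b ^ 2 / 3 - a) := by
  unfold eisensteinCount
  refine Finset.card_nbij' (fun p => (p.1 + b / 3, p.2 + b / 3))
    (fun p => (p.1 - b / 3, p.2 - b / 3)) ?_ ?_ ?_ ?_
  · rintro ⟨y, z⟩ h
    simp only [Finset.mem_coe, Finset.mem_filter, Finset.mem_univ, true_and] at h ⊢
    simp only [cubicDiff] at h
    field_simp
    linear_combination 9 * h
  · rintro ⟨y, z⟩ h
    simp only [Finset.mem_coe, Finset.mem_filter, Finset.mem_univ, true_and] at h ⊢
    simp only [cubicDiff]
    have e : (y - b / 3) ^ 2 + (y - b / 3) * (z - b / 3) + (z - b / 3) ^ 2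
        + b * (y - b / 3 + (z - b / 3)) + a = y ^ 2 + y * z + z ^ 2 - (b ^ 2 / 3 - a) := by
      field_simp
      ring
    rw [e, h, sub_self]
  · rintro ⟨y, z⟩ _; simp
  · rintro ⟨y, z⟩ _; simp

/-- For each `b` there is exactly one `a` such that `h - β` has a triple root for some `β`, namely
when `h - β = (Y + b/3)³`. -/
theorem sum_card_tripleRoot (h3 : (3 : F) ≠ 0) :
    ∑ b : K, ∑ a : K, ({y : F | algebraMap K F b = -3 * y ∧
        algebraMap K F a = 3 * y ^ 2} : Finset F).card = Fintype.card K := by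
  rw [← Finset.card_univ, ← mul_one (Finset.card _)]
  refine Finset.sum_const_nat fun b _ => ?_
  have h3K : (3 : K) ≠ 0 := by
    intro h
    apply h3
    rw [← map_ofNat (algebraMap K F) 3, h, map_zero]
  rw [Finset.sum_eq_single (b ^ 2 / 3)]
  · rw [Finset.card_eq_one]
    refine ⟨-algebraMap K F b / 3, ?_⟩
    ext y
    simp only [Finset.mem_filter, Finset.mem_univ, true_and, Finset.mem_singleton, map_div₀,
      map_pow, map_ofNat]
    constructor
    · rintro ⟨h, -⟩
      rw [h]; field_simp
    · rintro rfl
      constructor <;> field_simp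
  · intro a _ ha
    rw [Finset.card_eq_zero, Finset.filter_eq_empty_iff]
    rintro y - ⟨h1, h2⟩
    apply ha
    apply (algebraMap K F).injective
    rw [map_div₀, map_pow, map_ofNat, h1, h2]
    field_simp
  · simp

/-- The total number of missed values when the characteristic is not three. -/
theorem three_mul_totalMissed_of_three_ne_zero (h3 : (3 : F) ≠ 0) {q k : ℕ} (hk : k ≠ 0)
    (hK : Fintype.card K = q) (hF : Fintype.card F = q ^ k) :
    (3 * totalMissed K F : ℤ)
      = q * (q + legendreSym 3 q ^ k) * (q ^ k - legendreSym 3 q ^ k) := by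
  have key := three_mul_totalMissed (K := K) (F := F)
  classical
  rw [sum_card_tripleRoot h3] at key
  simp only [card_cubicDiff_eq_eisensteinCount h3] at key
  have h1 : ∀ b : K, ∑ a : K, eisensteinCount (algebraMap K F b ^ 2 / 3 - algebraMap K F a)
      = ∑ c : K, eisensteinCount (algebraMap K F c) := by
    intro b
    refine Fintype.sum_equiv (Equiv.subLeft (b ^ 2 / 3)) _ _ fun a => ?_
    rw [Equiv.subLeft_apply, map_sub, map_div₀, map_pow, map_ofNat]
  have h2 : (∑ c : K, eisensteinCount (algebraMap K F c) : ℤ)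
      = 1 + omegaCount F * (q ^ k - 1) + (q - 1) * (q ^ k + 1 - omegaCount F) := by
    rw [← Finset.add_sum_erase _ _ (Finset.mem_univ (0 : K)), map_zero, eisensteinCount_zero,
      Finset.sum_congr rfl fun c hc => eisensteinCount_of_ne_zero h3
        ((map_ne_zero (algebraMap K F)).2 (Finset.ne_of_mem_erase hc)),
      Finset.sum_const, Finset.card_erase_of_mem (Finset.mem_univ _), Finset.card_univ, hF, hK]
    have hq1 : 1 ≤ q := hK ▸ Fintype.card_pos
    have hQ1 : 1 ≤ q ^ k := Nat.one_le_pow _ _ hq1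
    push_cast [Nat.cast_sub hq1, Nat.cast_sub hQ1, nsmul_eq_mul]
    ring
  simp only [h1, Finset.sum_const, Finset.card_univ, hK, smul_eq_mul] at key
  have key' : (3 * totalMissed K F + q : ℤ)
      = q * ∑ c : K, (eisensteinCount (algebraMap K F c) : ℤ) := by exact_mod_cast key
  rw [h2, omegaCount_eq_legendreSym h3 hk hF] at key'
  have hq : ((q : ℤ) : ZMod 3) ≠ 0 := by
    intro h
    rw [Int.cast_natCast, ZMod.natCast_eq_zero_iff] at h
    exact h3 (three_dvd_card_iff.1 (hF ▸ dvd_pow h hk))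
  have hsq : (legendreSym 3 (q : ℤ) ^ k) ^ 2 = 1 := by
    rw [← pow_mul, mul_comm, pow_mul, legendreSym.sq_one 3 hq, one_pow]
  linear_combination key' + (q : ℤ) * hsq

/-- A unit `u` has its square in `K` exactly when `u ^ (2(q - 1)) = 1`, and in the cyclic group of
units such elements are counted by a greatest common divisor. -/
theorem sum_card_sq_eq_gcd :
    ∑ c : K, ({u : F | u ^ 2 = algebraMap K F c} : Finset F).card
      = 1 + (Fintype.card F - 1).gcd (2 * (Fintype.card K - 1)) := by
  have hker := IsCyclic.card_powMonoidHom_ker Fˣ (2 * (Fintype.card K - 1))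
  rw [Nat.card_eq_fintype_card (α := Fˣ), Fintype.card_units] at hker
  rw [← hker]
  rw [← Finset.card_sigma]
  have hq : 1 < Fintype.card K := Fintype.one_lt_card
  have hmem : ∀ u : F, u ≠ 0 → ((∃ c : K, algebraMap K F c = u ^ 2) ↔
      u ^ (2 * (Fintype.card K - 1)) = 1) := by
    intro u hu
    rw [mem_range_algebraMap_iff_pow_card]
    have : (u ^ 2) ^ Fintype.card K = u ^ (2 * (Fintype.card K - 1)) * u ^ 2 := by
      rw [← pow_mul, ← pow_add]; congr 1; omega
    rw [this]
    exact mul_eq_right₀ (pow_ne_zero 2 hu)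
  have e1 : (Finset.univ.sigma fun c : K => ({u : F | u ^ 2 = algebraMap K F c} : Finset F)).card
      = ({u : F | ∃ c : K, algebraMap K F c = u ^ 2} : Finset F).card := by
    refine Finset.card_bij (fun p _ => p.2) ?_ ?_ ?_
    · rintro ⟨c, u⟩ h
      simp only [Finset.mem_sigma, Finset.mem_univ, Finset.mem_filter, true_and] at h ⊢
      exact ⟨c, h.symm⟩
    · rintro ⟨c, u⟩ h ⟨c', u'⟩ h' (rfl : u = u')
      simp only [Finset.mem_sigma, Finset.mem_univ, Finset.mem_filter, true_and] at h h'
      rw [(algebraMap K F).injective (h.symm.trans h')]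
    · intro u h
      simp only [Finset.mem_filter, Finset.mem_univ, true_and] at h
      obtain ⟨c, hc⟩ := h
      exact ⟨⟨c, u⟩, by simp [hc], rfl⟩
  rw [e1]
  have e2 : ({u : F | ∃ c : K, algebraMap K F c = u ^ 2} : Finset F)
      = insert 0 ({u : F | u ≠ 0 ∧ u ^ (2 * (Fintype.card K - 1)) = 1} : Finset F) := by
    ext u
    simp only [Finset.mem_filter, Finset.mem_univ, true_and, Finset.mem_insert]
    by_cases hu : u = 0
    · subst hu
      simp only [true_or, iff_true]
      exact ⟨0, by simp⟩
    · simp [hu, hmem u hu]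
  rw [e2, Finset.card_insert_of_notMem (by simp), add_comm]
  congr 1
  rw [← Nat.card_eq_finsetCard]
  symm
  refine Nat.card_eq_of_bijective (fun u => ⟨((u : Fˣ) : F), ?_⟩) ⟨?_, ?_⟩
  · have hu : (u : Fˣ) ^ (2 * (Fintype.card K - 1)) = 1 := u.2
    simp only [Finset.mem_filter, Finset.mem_univ, true_and]
    exact ⟨Units.ne_zero _, by rw [← Units.val_pow_eq_pow_val, hu, Units.val_one]⟩
  · intro u v h
    exact Subtype.ext (Units.ext (congrArg Subtype.val h))
  · rintro ⟨u, hu⟩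
    simp only [Finset.mem_filter, Finset.mem_univ, true_and] at hu
    refine ⟨⟨Units.mk0 u hu.1, ?_⟩, rfl⟩
    rw [MonoidHom.mem_ker, powMonoidHom_apply]
    ext
    simpa using hu.2

theorem gcd_pow_sub_one_two_mul {q : ℕ} (hq : Odd q) (hq1 : 1 < q) (k : ℕ) :
    ((q ^ k - 1).gcd (2 * (q - 1)) : ℚ) = (q - 1) * ((3 + (-1) ^ k) / 2) := by
  have hs : (∑ i ∈ Finset.range k, q ^ i) * (q - 1) = q ^ k - 1 := by
    rw [Nat.geomSum_eq (by omega), Nat.div_mul_cancel]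
    simpa using Nat.sub_dvd_pow_sub_pow q 1 k
  have hpar : (∑ i ∈ Finset.range k, q ^ i) % 2 = k % 2 := by
    rw [Finset.sum_nat_mod, Finset.sum_congr rfl fun i _ => Nat.odd_iff.1 (hq.pow (n := i))]
    simp
  rw [← hs, Nat.gcd_mul_right, Nat.gcd_comm, Nat.gcd_rec, hpar]
  rcases Nat.even_or_odd k with hk | hk
  · rw [Nat.even_iff.1 hk, hk.neg_one_pow]
    push_cast [Nat.cast_sub hq1.le, Nat.gcd_zero_left]
    ring
  · rw [Nat.odd_iff.1 hk, hk.neg_one_pow]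
    push_cast [Nat.cast_sub hq1.le, Nat.gcd_one_left]
    ring

/-- In characteristic three the divided difference is `(y - z)² + b(y + z) + a`. For `b ≠ 0` it
is linear in the variable `y + z`. -/
theorem card_cubicDiff_of_ne_zero (h3 : (3 : F) = 0) {b : F} (hb : b ≠ 0) (a : F) :
    ({p : F × F | cubicDiff b a p.1 p.2 = 0} : Finset (F × F)).card = Fintype.card F := by
  have h2 : (2 : F) ≠ 0 := fun h => one_ne_zero (α := F) (by linear_combination h3 - h)
  rw [← Finset.card_univ]
  refine Finset.card_nbij' (fun p => p.1 - p.2)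
    (fun u => (((-a - u ^ 2) / b + u) / 2, ((-a - u ^ 2) / b - u) / 2)) ?_ ?_ ?_ ?_
  · intro p _; simp
  · intro u _
    simp only [Finset.mem_coe, Finset.mem_filter, Finset.mem_univ, true_and]
    simp only [cubicDiff]
    obtain ⟨s, hs⟩ : ∃ s, s = (-a - u ^ 2) / b := ⟨_, rfl⟩
    have hs' : b * s + a + u ^ 2 = 0 := by rw [hs]; field_simp; ring
    rw [← hs]
    field_simp
    linear_combination 4 * hs' + (s ^ 2 - u ^ 2) * h3
  · rintro ⟨y, z⟩ h
    simp only [Finset.mem_coe, Finset.mem_filter, Finset.mem_univ, true_and] at h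
    simp only [cubicDiff] at h
    have hs : (-a - (y - z) ^ 2) / b = y + z := by
      field_simp
      linear_combination -h + y * z * h3
    simp only [hs]
    refine Prod.ext ?_ ?_ <;> field_simp <;> ring
  · intro u _
    simp only
    field_simp
    ring

theorem card_cubicDiff_zero_left (h3 : (3 : F) = 0) (a : F) :
    ({p : F × F | cubicDiff 0 a p.1 p.2 = 0} : Finset (F × F)).card
      = Fintype.card F * ({u : F | u ^ 2 = -a} : Finset F).card := by
  rw [← Finset.card_univ, ← Finset.card_product]
  refine Finset.card_nbij' (fun p => (p.2, p.1 - p.2)) (fun p => (p.2 + p.1, p.1)) ?_ ?_ ?_ ?_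
  · rintro ⟨y, z⟩ h
    simp only [Finset.mem_coe, Finset.mem_filter, Finset.mem_univ, true_and,
      Finset.mem_product] at h ⊢
    simp only [cubicDiff] at h
    linear_combination h - y * z * h3
  · rintro ⟨z, u⟩ h
    simp only [Finset.mem_coe, Finset.mem_filter, Finset.mem_univ, true_and,
      Finset.mem_product] at h ⊢
    simp only [cubicDiff]
    linear_combination h + (u + z) * z * h3
  · rintro ⟨y, z⟩ _; simp
  · rintro ⟨y, z⟩ _; simp

/-- The total number of missed values in characteristic three. -/
theorem three_mul_totalMissed_of_three_eq_zero (h3 : (3 : F) = 0) {q k : ℕ}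
    (hK : Fintype.card K = q) (hF : Fintype.card F = q ^ k) :
    (3 * totalMissed K F : ℚ)
      = (q - 1) * (q + (3 + (-1) ^ k) / 2) * q ^ k := by
  classical
  have hq1 : 1 < q := hK ▸ Fintype.one_lt_card
  have h3K : (3 : K) = 0 := (algebraMap K F).injective (by rw [map_ofNat, h3, map_zero])
  have hodd : Odd q := by
    rw [← hK, Nat.odd_iff]
    apply FiniteField.odd_card_of_char_ne_two
    intro h
    have h2 : (2 : K) = 0 := by
      have := ringChar.Nat.cast_ringChar (R := K)
      rw [h] at this
      exact_mod_cast this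
    exact one_ne_zero (α := K) (by linear_combination h3K - h2)
  have key := three_mul_totalMissed (K := K) (F := F)
  simp only [h3, neg_zero, zero_mul, map_eq_zero] at key
  have t1 : ∑ b : K, ∑ a : K, ({_y : F | b = 0 ∧ a = 0} : Finset F).card = q ^ k := by
    rw [Finset.sum_eq_single 0, Finset.sum_eq_single 0]
    · simp [hF]
    · intro a _ ha; simp [ha]
    · simp
    · intro b _ hb; simp [hb]
    · simp
  rw [t1, ← Finset.add_sum_erase _ _ (Finset.mem_univ (0 : K)), map_zero,
    Finset.sum_congr rfl fun b hb => Finset.sum_congr rfl fun a _ =>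
      card_cubicDiff_of_ne_zero h3 ((map_ne_zero (algebraMap K F)).2 (Finset.ne_of_mem_erase hb))
        (algebraMap K F a)] at key
  simp only [card_cubicDiff_zero_left h3, ← Finset.mul_sum, Finset.sum_const,
    Finset.card_erase_of_mem (Finset.mem_univ (0 : K)), Finset.card_univ, hF, hK,
    smul_eq_mul] at key
  have t2 : ∑ a : K, ({u : F | u ^ 2 = -algebraMap K F a} : Finset F).card
      = 1 + (q ^ k - 1).gcd (2 * (q - 1)) := by
    rw [← hF, ← hK, ← sum_card_sq_eq_gcd]
    exact Fintype.sum_equiv (Equiv.neg K) _ _ fun a => by simp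
  rw [t2] at key
  have key' : (3 * totalMissed K F + q ^ k : ℚ)
      = q ^ k * (1 + ((q ^ k - 1).gcd (2 * (q - 1)) : ℕ)) + q * ((q - 1) * q ^ k) := by
    have e : ((q - 1 : ℕ) : ℚ) = q - 1 := by push_cast [Nat.cast_sub hq1.le]; rfl
    rw [← e]
    exact_mod_cast key
  rw [gcd_pow_sub_one_two_mul hodd hq1] at key'
  linear_combination key'

end Sum

/-! ### Endomorphisms with irreducible characteristic polynomial -/

section Irreducible

open Polynomial Module

variable {K V : Type*} [Field K] [AddCommGroup V] [Module K V]

theorem aeval_restrict_apply {T : End K V} {W : Submodule K V} (hW : ∀ x ∈ W, T x ∈ W) (p : K[X])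
    (w : W) : (aeval (T.restrict hW) p w : V) = aeval T p (w : V) := by
  induction p using Polynomial.induction_on' with
  | add p q hp hq => simp [hp, hq]
  | monomial n a =>
    simp only [aeval_monomial, Module.End.mul_apply, algebraMap_end_apply, Submodule.coe_smul]
    congr 1
    induction n with
    | zero => simp
    | succ n ih => rw [pow_succ', pow_succ', Module.End.mul_apply, Module.End.mul_apply,
        LinearMap.coe_restrict_apply, ih]

variable [FiniteDimensional K V]

/-- A nonzero polynomial of degree less than the dimension is coprime to an irreducible
characteristic polynomial, hence gives an injective map. -/
theorem aeval_apply_ne_zero_of_irreducible_charpoly {T : End K V}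
    (hT : Irreducible (LinearMap.charpoly T)) {p : K[X]} (hp : p ≠ 0)
    (hdeg : p.natDegree < finrank K V) {v : V} (hv : v ≠ 0) : aeval T p v ≠ 0 := by
  intro h
  have hcop : IsCoprime (LinearMap.charpoly T) p := by
    refine (hT.isCoprime_or_dvd p).resolve_right fun hd => ?_
    have := natDegree_le_of_dvd hd hp
    rw [LinearMap.charpoly_natDegree] at this
    omega
  obtain ⟨r, s, hrs⟩ := hcop
  have h1 := congrArg (fun f => aeval T f v) hrs
  simp only [map_add, map_mul, LinearMap.aeval_self_charpoly, mul_zero, zero_add,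
    Module.End.mul_apply, h, map_zero, map_one, Module.End.one_apply] at h1
  exact hv h1.symm

theorem eq_top_of_irreducible_charpoly {T : End K V} (hT : Irreducible (LinearMap.charpoly T))
    {W : Submodule K V} (hW : ∀ x ∈ W, T x ∈ W) (hW0 : W ≠ ⊥) : W = ⊤ := by
  by_contra hne
  obtain ⟨w, hw, hw0⟩ := W.exists_mem_ne_zero_of_ne_bot hW0
  refine aeval_apply_ne_zero_of_irreducible_charpoly hT
    (LinearMap.charpoly_monic (T.restrict hW)).ne_zero ?_ hw0 ?_
  · rw [LinearMap.charpoly_natDegree]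
    exact Submodule.finrank_lt hne
  · rw [← aeval_restrict_apply hW _ ⟨w, hw⟩, LinearMap.aeval_self_charpoly]
    rfl

theorem irreducible_charpoly_of_minpoly {T : End K V} (hT : Irreducible (minpoly K T))
    (hdeg : (minpoly K T).natDegree = finrank K V) : Irreducible (LinearMap.charpoly T) := by
  rwa [eq_of_monic_of_dvd_of_natDegree_le (minpoly.monic (LinearMap.isIntegral T))
    (LinearMap.charpoly_monic T) (LinearMap.minpoly_dvd_charpoly T)
    (by rw [hdeg, LinearMap.charpoly_natDegree])]

/-- An endomorphism whose minimal polynomial is irreducible of the largest possible degree, the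
dimension of the space. Equivalently, it has no nontrivial invariant subspace. -/
def IsSimpleEnd (A : End K V) : Prop :=
  Irreducible (minpoly K A) ∧ (minpoly K A).natDegree = finrank K V

/-- Kernels of polynomials in `A` give the irreducibility of the minimal polynomial, and cyclic
subspaces give its degree. -/
theorem isSimpleEnd_of_forall_invariant [Nontrivial V] {A : End K V}
    (hA : ∀ W : Submodule K V, (∀ x ∈ W, A x ∈ W) → W ≠ ⊥ → W = ⊤) : IsSimpleEnd A := by
  have hint : IsIntegral K A := LinearMap.isIntegral A
  have hcomm : ∀ (p : K[X]) (x : V), aeval A p (A x) = A (aeval A p x) := fun p x => by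
    have h : aeval A (p * X) = aeval A (X * p) := by rw [mul_comm]
    rw [map_mul, map_mul, aeval_X] at h
    exact LinearMap.congr_fun h x
  constructor
  · -- An irreducible factor `f` of the minimal polynomial has a nonzero kernel, hence kills `V`.
    obtain ⟨f, hf, g, hg⟩ := WfDvdMonoid.exists_irreducible_factor
      (minpoly.not_isUnit K A) (minpoly.ne_zero hint)
    have hg0 : g ≠ 0 := by rintro rfl; exact minpoly.ne_zero hint (by rw [hg, mul_zero])
    have hgA : aeval A g ≠ 0 := by
      intro h
      have h1 := natDegree_le_of_dvd (minpoly.dvd K A h) hg0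
      rw [hg, natDegree_mul hf.ne_zero hg0] at h1
      have := hf.natDegree_pos
      omega
    obtain ⟨x, hx⟩ : ∃ x, aeval A g x ≠ 0 := by
      by_contra! hall
      exact hgA (LinearMap.ext hall)
    have hker : LinearMap.ker (aeval A f) = ⊤ := by
      refine hA _ (fun y hy => ?_) fun hbot => hx ?_
      · rw [LinearMap.mem_ker] at hy ⊢
        rw [hcomm, hy, map_zero]
      · rw [← Submodule.mem_bot K, ← hbot, LinearMap.mem_ker, ← Module.End.mul_apply, ← map_mul,
          ← hg, minpoly.aeval, LinearMap.zero_apply]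
    exact (associated_of_dvd_dvd (minpoly.dvd K A (LinearMap.ker_eq_top.1 hker))
      ⟨g, hg⟩).irreducible_iff.2 hf
  · apply le_antisymm
    · rw [← LinearMap.charpoly_natDegree A]
      exact natDegree_le_of_dvd (LinearMap.minpoly_dvd_charpoly A)
        (LinearMap.charpoly_monic A).ne_zero
    · obtain ⟨v, hv⟩ := exists_ne (0 : V)
      -- The cyclic subspace generated by `v` is invariant, hence everything.
      let ev : K[X] →ₗ[K] V := LinearMap.applyₗ v ∘ₗ (aeval A : K[X] →ₐ[K] End K V).toLinearMap
      have htop : LinearMap.range ev = ⊤ := by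
        refine hA _ ?_ ?_
        · rintro _ ⟨p, rfl⟩
          exact ⟨X * p, by simp [ev]⟩
        · intro h
          have : ev 1 ∈ LinearMap.range ev := ⟨1, rfl⟩
          rw [h, Submodule.mem_bot] at this
          exact hv (by simpa [ev] using this)
      -- Modulo the minimal polynomial, polynomials of degree less than its degree suffice.
      let ev' := ev ∘ₗ (degreeLT K (minpoly K A).natDegree).subtype
      have hsurj : Function.Surjective ev' := by
        intro w
        obtain ⟨p, hp⟩ : w ∈ LinearMap.range ev := htop ▸ Submodule.mem_top
        refine ⟨⟨p %ₘ minpoly K A, ?_⟩, ?_⟩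
        · rw [mem_degreeLT, ← degree_eq_natDegree (minpoly.ne_zero hint)]
          exact degree_modByMonic_lt _ (minpoly.monic hint)
        · rw [← hp]
          change aeval A (p %ₘ minpoly K A) v = aeval A p v
          rw [aeval_modByMonic_eq_self_of_root (minpoly.aeval K A)]
      have h1 := ev'.finrank_le_finrank_of_surjective hsurj
      rwa [LinearEquiv.finrank_eq (degreeLTEquiv K _), finrank_fin_fun] at h1

end Irreducible

/-! ### Transformation shift registers of order three -/

section Register

open Polynomial Module

/-- The coefficients `(A, bA, aA)` of a register of order three with first scalar `1`. -/
def tsrCoeff {K E : Type*} [Field K] [AddCommGroup E] [Module K E] (b a : K) (A : End K E) :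
    Fin 3 → End K E := ![A, b • A, a • A]

variable {K E : Type*} [Field K] [AddCommGroup E] [Module K E]

theorem tsrTransition_three_apply (C : Fin 3 → End K E) (s : Fin 3 → E) :
    tsrTransition K E 3 C s = ![s 1, s 2, C 0 (s 0) + C 1 (s 1) + C 2 (s 2)] := by
  ext i
  fin_cases i
  · simp [tsrTransition]
  · simp [tsrTransition]
  · simp [tsrTransition, Fin.sum_univ_three]

theorem tsrTransition_tsrCoeff_apply (b a : K) (A : End K E) (s : Fin 3 → E) :
    tsrTransition K E 3 (tsrCoeff b a A) s = ![s 1, s 2, A (s 0 + b • s 1 + a • s 2)] := by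
  rw [tsrTransition_three_apply]
  simp [tsrCoeff]

theorem isTSR_tsrCoeff (b a : K) (A : End K E) : IsTSR K E 3 (tsrCoeff b a A) := by
  refine ⟨![1, b, a], A, fun i => ?_⟩
  fin_cases i <;> simp [tsrCoeff]

theorem tsrTransition_conj (b a : K) (A : End K E) (φ : E ≃ₗ[K] E) :
    tsrTransition K E 3 (tsrCoeff b a (φ.conj A))
      = (LinearEquiv.piCongrRight fun _ : Fin 3 => φ).conj
          (tsrTransition K E 3 (tsrCoeff b a A)) := by
  refine LinearMap.ext fun s => ?_
  rw [LinearEquiv.conj_apply_apply, tsrTransition_tsrCoeff_apply, tsrTransition_tsrCoeff_apply]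
  ext i
  fin_cases i <;> simp [LinearEquiv.conj_apply_apply]

variable [FiniteDimensional K E]

theorem irreducible_charpoly_conj (b a : K) (A : End K E) (φ : E ≃ₗ[K] E) :
    Irreducible (LinearMap.charpoly (tsrTransition K E 3 (tsrCoeff b a (φ.conj A)))) ↔
      Irreducible (LinearMap.charpoly (tsrTransition K E 3 (tsrCoeff b a A))) := by
  rw [tsrTransition_conj, LinearEquiv.charpoly_conj]

theorem injective_of_irreducible_charpoly [Nontrivial E] {T : End K (Fin 3 → E)}
    (hT : Irreducible (LinearMap.charpoly T)) {s : Fin 3 → E} (hs : s ≠ 0) : T s ≠ 0 := by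
  have := aeval_apply_ne_zero_of_irreducible_charpoly hT (p := X) X_ne_zero ?_ hs
  · simpa using this
  · rw [natDegree_X, finrank_pi_fintype]
    have := finrank_pos (R := K) (M := E)
    simp
    omega

/-- The feedback map `C₀` of an irreducible register is injective, so its first scalar can be
normalised to `1`. -/
theorem exists_eq_tsrCoeff [Nontrivial E] {C : Fin 3 → End K E} (hC : C ∈ TSRI K E 3) :
    ∃ (b a : K) (A : End K E), C = tsrCoeff b a A := by
  obtain ⟨⟨c, A, hA⟩, hirr⟩ := hC
  have hc : c 0 ≠ 0 := by
    intro h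
    obtain ⟨v, hv⟩ := exists_ne (0 : E)
    refine injective_of_irreducible_charpoly hirr (s := ![v, 0, 0]) ?_ ?_
    · intro h; exact hv (by simpa using congrFun h 0)
    · rw [tsrTransition_three_apply]
      ext i
      fin_cases i <;> simp [hA, h]
  refine ⟨c 1 / c 0, c 2 / c 0, c 0 • A, ?_⟩
  ext i : 1
  fin_cases i <;> simp [tsrCoeff, hA, smul_smul, hc]

/-- An invariant subspace `W` of `A` gives the invariant subspace `W³` of the register. -/
theorem isSimpleEnd_of_irreducible_charpoly [Nontrivial E] {b a : K} {A : End K E}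
    (h : Irreducible (LinearMap.charpoly (tsrTransition K E 3 (tsrCoeff b a A)))) :
    IsSimpleEnd A := by
  refine isSimpleEnd_of_forall_invariant fun W hW hW0 => ?_
  have htop := eq_top_of_irreducible_charpoly h (W := Submodule.pi Set.univ fun _ => W) ?_ ?_
  · rw [eq_top_iff]
    intro x _
    have : (fun _ => x : Fin 3 → E) ∈ Submodule.pi Set.univ fun _ => W :=
      htop ▸ Submodule.mem_top
    exact this 0 (Set.mem_univ _)
  · intro s hs
    have hs' : ∀ i, s i ∈ W := fun i => hs i (Set.mem_univ _)
    rw [tsrTransition_tsrCoeff_apply]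
    intro i _
    fin_cases i
    · exact hs' 1
    · exact hs' 2
    · exact hW _ (W.add_mem (W.add_mem (hs' 0) (W.smul_mem _ (hs' 1))) (W.smul_mem _ (hs' 2)))
  · obtain ⟨w, hw, hw0⟩ := W.exists_mem_ne_zero_of_ne_bot hW0
    intro hbot
    have : (fun _ => w : Fin 3 → E) ∈ Submodule.pi Set.univ fun _ => W := fun _ _ => hw
    rw [hbot, Submodule.mem_bot] at this
    exact hw0 (congrFun this 0)

end Register

/-! ### Registers given by a multiplication map -/

section Multiplication

open Polynomial Module IntermediateField

variable {K L : Type*} [Field K] [Field L] [Algebra K L]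

/-- The `L`-linear state transition map of the register `s_{k+3} = α (s_k + b s_{k+1} + a s_{k+2})`
over `L`. -/
def companionEnd (b a α : L) : End L (Fin 3 → L) :=
  LinearMap.pi ![LinearMap.proj 1, LinearMap.proj 2,
    α • (LinearMap.proj 0 + b • LinearMap.proj 1 + a • LinearMap.proj 2)]

theorem companionEnd_apply (b a α : L) (s : Fin 3 → L) :
    companionEnd b a α s = ![s 1, s 2, α * (s 0 + b * s 1 + a * s 2)] := by
  ext i
  fin_cases i <;> simp [companionEnd]
  ring

theorem restrictScalars_companionEnd (b a : K) (α : L) :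
    (companionEnd (algebraMap K L b) (algebraMap K L a) α).restrictScalars K
      = tsrTransition K L 3 (tsrCoeff b a (LinearMap.mulLeft K α)) := by
  refine LinearMap.ext fun s => ?_
  rw [tsrTransition_tsrCoeff_apply, LinearMap.restrictScalars_apply, companionEnd_apply]
  simp [Algebra.smul_def]

/-- The cubic polynomial `X³ - α(1 + bX + aX²)`. -/
noncomputable def companionPoly (b a α : L) : L[X] := X ^ 3 - C α * (1 + C b * X + C a * X ^ 2)

theorem natDegree_companionPoly (b a α : L) : (companionPoly b a α).natDegree = 3 := by
  unfold companionPoly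
  compute_degree!

theorem monic_companionPoly (b a α : L) : (companionPoly b a α).Monic := by
  unfold companionPoly
  monicity!

theorem aeval_companionEnd (b a α : L) :
    aeval (companionEnd b a α) (companionPoly b a α) = 0 := by
  refine LinearMap.ext fun s => ?_
  simp only [companionPoly, map_sub, map_mul, map_add, aeval_X, aeval_C, map_one,
    LinearMap.sub_apply, Module.End.mul_apply, LinearMap.add_apply, Module.End.one_apply,
    algebraMap_end_apply, pow_succ, pow_zero, one_mul, companionEnd_apply]
  ext i
  fin_cases i <;> simp [Matrix.vecHead, Matrix.vecTail] <;> ring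

theorem irreducible_companionPoly {b a α : L} (hα : α ≠ 0) (h : ∀ y, cubicVal b a y ≠ α⁻¹) :
    Irreducible (companionPoly b a α) := by
  refine irreducible_of_degree_le_three_of_not_isRoot (by rw [natDegree_companionPoly]; decide) ?_
  intro x hx
  have hx' : x ^ 3 = α * (1 + b * x + a * x ^ 2) := by
    have : eval x (companionPoly b a α) = 0 := hx
    simp only [companionPoly, eval_sub, eval_mul, eval_add, eval_pow, eval_X, eval_C,
      eval_one] at this
    linear_combination this
  have hx0 : x ≠ 0 := by
    rintro rfl
    apply hα
    linear_combination -hx'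
  -- The reciprocal polynomial turns the root `x` into the value `α⁻¹` at `x⁻¹`.
  refine h x⁻¹ ?_
  rw [cubicVal]
  field_simp
  linear_combination -hx'

/-- A root `x` of `X³ - α(1 + bX + aX²)` over `L = K(α)` generates its extension already over `K`,
since `α` is the quotient of `x³` by `1 + bx + ax²`. -/
theorem adjoin_root_companionPoly_eq_top {b a : K} {α : L} (hα : K⟮α⟯ = ⊤)
    (hirr : Irreducible (companionPoly (algebraMap K L b) (algebraMap K L a) α)) :
    haveI : Fact (Irreducible (companionPoly (algebraMap K L b) (algebraMap K L a) α)) := ⟨hirr⟩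
    K⟮AdjoinRoot.root (companionPoly (algebraMap K L b) (algebraMap K L a) α)⟯ = ⊤ := by
  have : Fact (Irreducible (companionPoly (algebraMap K L b) (algebraMap K L a) α)) := ⟨hirr⟩
  set P := companionPoly (algebraMap K L b) (algebraMap K L a) α with hP
  set x := AdjoinRoot.root P with hx
  have hxE : x ∈ K⟮x⟯ := mem_adjoin_simple_self K x
  have hroot : x ^ 3 = algebraMap L (AdjoinRoot P) α *
      (1 + algebraMap K (AdjoinRoot P) b * x + algebraMap K (AdjoinRoot P) a * x ^ 2) := by
    have h1 : aeval x P = 0 := by rw [AdjoinRoot.aeval_eq, AdjoinRoot.mk_self]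
    simp only [hP, companionPoly, map_sub, map_mul, map_add, map_pow, aeval_X, aeval_C,
      map_one] at h1
    rw [IsScalarTower.algebraMap_apply K L (AdjoinRoot P),
      IsScalarTower.algebraMap_apply K L (AdjoinRoot P)]
    linear_combination h1
  have hx0 : x ≠ 0 := by
    intro h0
    have h1 : P ∣ X := by
      rw [← AdjoinRoot.mk_eq_zero, AdjoinRoot.mk_X]; exact h0
    have := natDegree_le_of_dvd h1 X_ne_zero
    rw [hP, natDegree_companionPoly, natDegree_X] at this
    omega
  have hαE : algebraMap L (AdjoinRoot P) α ∈ K⟮x⟯ := by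
    set g := 1 + algebraMap K (AdjoinRoot P) b * x + algebraMap K (AdjoinRoot P) a * x ^ 2
    have hg : g ∈ K⟮x⟯ :=
      add_mem (add_mem (one_mem _) (mul_mem (IntermediateField.algebraMap_mem _ b) hxE))
        (mul_mem (IntermediateField.algebraMap_mem _ a) (pow_mem hxE 2))
    have hg0 : g ≠ 0 := by
      intro h
      rw [h, mul_zero] at hroot
      exact hx0 (pow_eq_zero_iff (by norm_num) |>.1 hroot)
    rw [eq_div_of_mul_eq hg0 hroot.symm]
    exact div_mem (pow_mem hxE 3) hg
  have hL : ∀ l : L, algebraMap L (AdjoinRoot P) l ∈ K⟮x⟯ := by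
    have : K⟮α⟯ ≤ K⟮x⟯.comap (IsScalarTower.toAlgHom K L (AdjoinRoot P)) := by
      rw [adjoin_simple_le_iff]
      exact hαE
    intro l
    exact this (hα ▸ mem_top)
  rw [eq_top_iff]
  intro z _
  have hz : z ∈ Algebra.adjoin L {x} := by rw [hx, AdjoinRoot.adjoinRoot_eq_top]; trivial
  induction hz using Algebra.adjoin_induction with
  | mem y hy => rw [Set.mem_singleton_iff.1 hy]; exact hxE
  | algebraMap l => exact hL l
  | add y z _ _ hy hz => exact add_mem (hy mem_top) (hz mem_top)
  | mul y z _ _ hy hz => exact mul_mem (hy mem_top) (hz mem_top)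

variable [FiniteDimensional K L]

/-- The field `L[X] / (X³ - α(1 + bX + aX²))` is generated over `K` by the class `x` of `X`. It acts
on `L³` with `x` acting as the register, which therefore has the minimal polynomial of `x`. -/
theorem irreducible_charpoly_mulLeft {b a : K} {α : L} (hα : K⟮α⟯ = ⊤) (hα0 : α ≠ 0)
    (h : ∀ y, cubicVal (algebraMap K L b) (algebraMap K L a) y ≠ α⁻¹) :
    Irreducible (LinearMap.charpoly
      (tsrTransition K L 3 (tsrCoeff b a (LinearMap.mulLeft K α)))) := by
  have hirr := irreducible_companionPoly hα0 h
  have htop := adjoin_root_companionPoly_eq_top hα hirr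
  have : Fact (Irreducible (companionPoly (algebraMap K L b) (algebraMap K L a) α)) := ⟨hirr⟩
  set P := companionPoly (algebraMap K L b) (algebraMap K L a) α with hP
  have hmonic : P.Monic := monic_companionPoly _ _ _
  let pb := AdjoinRoot.powerBasis' hmonic
  have hgen : pb.gen = AdjoinRoot.root P := rfl
  have hmin : minpoly L pb.gen = P := by
    rw [hgen, AdjoinRoot.minpoly_root hmonic.ne_zero, hmonic.leadingCoeff, inv_one, C_1, mul_one]
  let S := companionEnd (algebraMap K L b) (algebraMap K L a) α
  let σ : AdjoinRoot P →ₐ[L] End L (Fin 3 → L) :=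
    pb.lift S (by rw [hmin]; exact aeval_companionEnd _ _ _)
  let τ : AdjoinRoot P →ₐ[K] End K (Fin 3 → L) :=
    { toFun := fun z => (σ z).restrictScalars K
      map_one' := by rw [map_one]; rfl
      map_mul' := fun y z => by rw [map_mul]; rfl
      map_zero' := by rw [map_zero]; rfl
      map_add' := fun y z => by rw [map_add]; rfl
      commutes' := fun c => by
        rw [IsScalarTower.algebraMap_apply K L (AdjoinRoot P), AlgHom.commutes]
        refine LinearMap.ext fun s => ?_
        simp [algebraMap_end_apply] }
  have hτ : τ (AdjoinRoot.root P)
      = tsrTransition K L 3 (tsrCoeff b a (LinearMap.mulLeft K α)) := by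
    rw [← restrictScalars_companionEnd]
    change (σ (AdjoinRoot.root P)).restrictScalars K = _
    rw [← hgen, PowerBasis.lift_gen]
  have hfin : FiniteDimensional L (AdjoinRoot P) := pb.finite
  have hfinK : FiniteDimensional K (AdjoinRoot P) := FiniteDimensional.trans K L _
  rw [← hτ]
  have hmp := minpoly.algHom_eq τ τ.toRingHom.injective (AdjoinRoot.root P)
  apply irreducible_charpoly_of_minpoly
  · rw [hmp]
    exact minpoly.irreducible (IsIntegral.of_finite K _)
  · rw [hmp, (Field.primitive_element_iff_minpoly_natDegree_eq K _).1 htop,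
      ← finrank_mul_finrank K L, pb.finrank, finrank_pi_fintype]
    have : pb.dim = 3 := natDegree_companionPoly _ _ _
    rw [this]
    simp [mul_comm]

theorem cubicVal_ne_of_irreducible_charpoly {b a : K} {α : L}
    (h : Irreducible (LinearMap.charpoly
      (tsrTransition K L 3 (tsrCoeff b a (LinearMap.mulLeft K α))))) :
    α ≠ 0 ∧ ∀ y, cubicVal (algebraMap K L b) (algebraMap K L a) y ≠ α⁻¹ := by
  have hα : α ≠ 0 := by
    rintro rfl
    refine injective_of_irreducible_charpoly h (s := ![1, 0, 0]) ?_ ?_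
    · intro h; exact one_ne_zero (α := L) (by simpa using congrFun h 0)
    · rw [tsrTransition_tsrCoeff_apply]
      simp
  refine ⟨hα, fun y hy => ?_⟩
  have hy0 : y ≠ 0 := by
    rintro rfl
    apply inv_ne_zero hα
    rw [← hy, cubicVal]; ring
  -- With `x = y⁻¹` the `L`-line through the eigenvector `(1, x, x²)` is invariant.
  let f : L →ₗ[K] (Fin 3 → L) := LinearMap.pi
    ![LinearMap.id, LinearMap.mulLeft K y⁻¹, LinearMap.mulLeft K (y⁻¹ ^ 2)]
  have hf : ∀ l, f l = ![l, y⁻¹ * l, y⁻¹ ^ 2 * l] := by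
    intro l
    ext i
    fin_cases i <;> simp [f]
  have htop := eq_top_of_irreducible_charpoly h (W := LinearMap.range f) ?_ ?_
  · obtain ⟨l, hl⟩ : ![0, 1, 0] ∈ LinearMap.range f := htop ▸ Submodule.mem_top
    rw [hf] at hl
    have h0 : l = 0 := by simpa using congrFun hl 0
    have h1 : y⁻¹ * l = 1 := by simpa using congrFun hl 1
    rw [h0, mul_zero] at h1
    exact zero_ne_one h1
  · rintro _ ⟨l, rfl⟩
    refine ⟨y⁻¹ * l, ?_⟩
    rw [tsrTransition_tsrCoeff_apply, hf, hf]
    have hlast : y⁻¹ ^ 2 * (y⁻¹ * l) = α * (l + algebraMap K L b * (y⁻¹ * l)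
        + algebraMap K L a * (y⁻¹ ^ 2 * l)) := by
      have hy' : α * (y ^ 3 + algebraMap K L b * y ^ 2 + algebraMap K L a * y) = 1 := by
        rw [cubicVal] at hy
        rw [hy, mul_inv_cancel₀ hα]
      field_simp
      linear_combination -l * hy'
    ext i
    fin_cases i
    · simp
    · simp; ring
    · simpa [Algebra.smul_def] using hlast
  · intro hbot
    have : f 1 ∈ LinearMap.range f := ⟨1, rfl⟩
    rw [hbot, Submodule.mem_bot, hf] at this
    exact one_ne_zero (α := L) (by simpa using congrFun this 0)

/-- The register with feedback map the multiplication by a generator `α` of `L` over `K` is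
irreducible exactly when the cubic `Y³ + bY² + aY` misses the value `α⁻¹`. -/
theorem irreducible_charpoly_mulLeft_iff {b a : K} {α : L} (hα : K⟮α⟯ = ⊤) :
    Irreducible (LinearMap.charpoly
      (tsrTransition K L 3 (tsrCoeff b a (LinearMap.mulLeft K α)))) ↔
    α ≠ 0 ∧ ∀ y, cubicVal (algebraMap K L b) (algebraMap K L a) y ≠ α⁻¹ :=
  ⟨cubicVal_ne_of_irreducible_charpoly, fun h => irreducible_charpoly_mulLeft hα h.1 h.2⟩

end Multiplication

/-! ### Counting registers by conjugation -/

section Counting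

open Polynomial Module IntermediateField

variable {K L : Type*} [Field K] [Field L] [Algebra K L]

/-- The endomorphisms `A` for which the register with coefficients `(A, bA, aA)` is irreducible. -/
def irreducibleEnds (L : Type*) {K : Type*} [Field K] [Field L] [Algebra K L]
    [FiniteDimensional K L] (b a : K) : Set (End K L) :=
  {A | Irreducible (LinearMap.charpoly (tsrTransition K L 3 (tsrCoeff b a A)))}

/-- The generators of `L` over `K` that are missed by the cubic `Y³ + bY² + aY` on `L`. -/
def missedGenerators (L : Type*) {K : Type*} [Field K] [Field L] [Algebra K L] (b a : K) : Set L :=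
  {β | K⟮β⟯ = ⊤ ∧ ∀ y, cubicVal (algebraMap K L b) (algebraMap K L a) y ≠ β}

theorem adjoin_simple_inv (x : L) : K⟮x⁻¹⟯ = K⟮x⟯ := by
  apply le_antisymm
  · rw [adjoin_simple_le_iff]; exact inv_mem (mem_adjoin_simple_self K x)
  · rw [adjoin_simple_le_iff]
    have := inv_mem (mem_adjoin_simple_self K x⁻¹)
    rwa [inv_inv] at this

/-- A conjugate of multiplication by `α` has the same minimal polynomial as `α`. -/
theorem minpoly_conj_mulLeft (φ : L ≃ₗ[K] L) (α : L) :
    minpoly K (φ.conj (LinearMap.mulLeft K α)) = minpoly K α := by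
  let f : L →ₐ[K] End K L := (φ.conjAlgEquiv K).toAlgHom.comp (Algebra.lmul K L)
  exact minpoly.algHom_eq f f.toRingHom.injective α

variable [FiniteDimensional K L]

theorem algebra_adjoin_eq_top {α : L} (hα : K⟮α⟯ = ⊤) : Algebra.adjoin K {α} = ⊤ := by
  rw [← adjoin_simple_toSubalgebra_of_isAlgebraic (Algebra.IsAlgebraic.isAlgebraic α), hα,
    top_toSubalgebra]

/-- An intertwiner between multiplication by a generator and `A` is determined by its value
at `1`. -/
theorem conj_mulLeft_injective {α : L} (hα : K⟮α⟯ = ⊤) {φ ψ : L ≃ₗ[K] L}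
    (h : φ.conj (LinearMap.mulLeft K α) = ψ.conj (LinearMap.mulLeft K α)) (h1 : φ 1 = ψ 1) :
    φ = ψ := by
  have hφ : ∀ x, φ (α * x) = φ.conj (LinearMap.mulLeft K α) (φ x) := fun x => by
    simp [LinearEquiv.conj_apply_apply]
  have hψ : ∀ x, ψ (α * x) = ψ.conj (LinearMap.mulLeft K α) (ψ x) := fun x => by
    simp [LinearEquiv.conj_apply_apply]
  have key : ∀ x ∈ Algebra.adjoin K {α}, ∀ y, φ y = ψ y → φ (x * y) = ψ (x * y) := by
    intro x hx
    induction hx using Algebra.adjoin_induction with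
    | mem x hx =>
      intro y hy
      rw [Set.mem_singleton_iff.1 hx, hφ, hψ, h, hy]
    | algebraMap c => intro y hy; rw [← Algebra.smul_def, map_smul, map_smul, hy]
    | add x z _ _ hx hz => intro y hy; rw [add_mul, map_add, map_add, hx y hy, hz y hy]
    | mul x z _ _ hx hz => intro y hy; rw [mul_assoc]; exact hx _ (hz _ hy)
  ext x
  have := key x (by rw [algebra_adjoin_eq_top hα]; trivial) 1 h1
  rwa [mul_one] at this

/-- If the minimal polynomial of `A` has a root `α` generating `L`, then `A` is conjugate to
multiplication by `α`, by an isomorphism with a prescribed nonzero value at `1`. -/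
theorem exists_conj_mulLeft_eq {A : End K L} {α : L} (hα : K⟮α⟯ = ⊤)
    (hA : minpoly K α = minpoly K A) {v : L} (hv : v ≠ 0) :
    ∃ φ : L ≃ₗ[K] L, φ 1 = v ∧ φ.conj (LinearMap.mulLeft K α) = A := by
  let pb := PowerBasis.ofAdjoinEqTop (IsIntegral.of_finite K α) (algebra_adjoin_eq_top hα)
  have hgen : pb.gen = α := PowerBasis.ofAdjoinEqTop_gen _ _
  let σ : L →ₐ[K] End K L := pb.lift A (by rw [hgen, hA, minpoly.aeval])
  have hσ : σ α = A := by rw [← hgen]; exact pb.lift_gen _ _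
  let f : L →ₗ[K] L := LinearMap.applyₗ v ∘ₗ σ.toLinearMap
  have hf : ∀ x, f x = σ x v := fun x => rfl
  have hinj : Function.Injective f := by
    rw [injective_iff_map_eq_zero]
    intro x hx
    by_contra hx0
    apply hv
    have : σ (x⁻¹ * x) v = 0 := by
      rw [map_mul, Module.End.mul_apply, ← hf x, hx, map_zero]
    rwa [inv_mul_cancel₀ hx0, map_one, Module.End.one_apply] at this
  refine ⟨LinearEquiv.ofInjectiveEndo f hinj, ?_, ?_⟩
  · simp [hf]
  · refine LinearMap.ext fun y => ?_
    obtain ⟨x, rfl⟩ := (LinearEquiv.ofInjectiveEndo f hinj).surjective y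
    rw [LinearEquiv.conj_apply_apply, LinearEquiv.symm_apply_apply]
    simp [hf, hσ]

theorem mem_irreducibleEnds_conj_iff {b a : K} {α : L} (hα : K⟮α⟯ = ⊤) (φ : L ≃ₗ[K] L) :
    φ.conj (LinearMap.mulLeft K α) ∈ irreducibleEnds L b a ↔ α⁻¹ ∈ missedGenerators L b a := by
  change Irreducible _ ↔ _
  rw [irreducible_charpoly_conj, irreducible_charpoly_mulLeft_iff hα]
  change _ ↔ _ ∧ _
  rw [adjoin_simple_inv]
  refine ⟨fun h => ⟨hα, h.2⟩, fun h => ⟨?_, h.2⟩⟩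
  rintro rfl
  exact h.2 0 (by simp [cubicVal])

variable [Finite K]

/-- An irreducible polynomial over a finite field splits in every extension whose degree is a
multiple of the degree of the polynomial. -/
theorem splits_map_of_natDegree_dvd_finrank {f : K[X]} (hf : Irreducible f)
    (hdvd : f.natDegree ∣ finrank K L) : (f.map (algebraMap K L)).Splits := by
  have hfin : Finite L := Module.finite_of_finite K
  have h1 : f ∣ X ^ Nat.card L - X := by
    rw [Module.natCard_eq_pow_finrank (K := K)]
    exact (Irreducible.natDegree_dvd_iff_dvd_X_pow_card_pow_sub_X hf).1 hdvd
  have h2 := Polynomial.map_dvd (algebraMap K L) h1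
  rw [Polynomial.map_sub, Polynomial.map_pow, map_X] at h2
  refine Polynomial.splits_X_pow_nat_card_sub_X.of_dvd ?_ h2
  exact FiniteField.X_pow_card_sub_X_ne_zero L Finite.one_lt_card

/-- The minimal polynomial of `A` splits in `L` because its degree is `[L : K]`. -/
theorem card_roots_minpoly {A : End K L} (hA : IsSimpleEnd A) :
    Nat.card {α : L // aeval α (minpoly K A) = 0} = finrank K L := by
  have hsplit := splits_map_of_natDegree_dvd_finrank (L := L) hA.1 (by rw [hA.2])
  have h := card_rootSet_eq_natDegree (PerfectField.separable_of_irreducible hA.1) hsplit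
  rw [hA.2, ← Nat.card_eq_fintype_card] at h
  rw [← h]
  refine Nat.card_congr (Equiv.subtypeEquivRight fun α => ?_)
  rw [mem_rootSet]
  simp [hA.1.ne_zero]

/-- Conjugating multiplications by generators counts every irreducible register once for each
root of the minimal polynomial of `A` in `L` and each nonzero vector, the image of `1`. -/
theorem card_mul_card_missedGenerators (b a : K) :
    Nat.card (L ≃ₗ[K] L) * Nat.card (missedGenerators L b a)
      = Nat.card (irreducibleEnds L b a) * (finrank K L * (Nat.card L - 1)) := by
  have hfin : Finite L := Module.finite_of_finite K
  have hfinE : Finite (End K L) := Finite.of_injective _ DFunLike.coe_injective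
  have : Fintype (irreducibleEnds L b a) := Fintype.ofFinite _
  have hsimple : ∀ A : irreducibleEnds L b a, IsSimpleEnd (A : End K L) :=
    fun A => isSimpleEnd_of_irreducible_charpoly A.2
  have hcard : Nat.card (Σ A : irreducibleEnds L b a,
      {α : L // aeval α (minpoly K (A : End K L)) = 0} × {v : L // v ≠ 0})
      = Nat.card (irreducibleEnds L b a) * (finrank K L * (Nat.card L - 1)) := by
    rw [Nat.card_sigma, Finset.sum_congr rfl fun A _ => by
      rw [Nat.card_prod, card_roots_minpoly (hsimple A)], Finset.sum_const, Finset.card_univ,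
      ← Nat.card_eq_fintype_card, smul_eq_mul]
    congr 2
    have := Fintype.ofFinite L
    classical
    rw [Nat.card_eq_fintype_card, Nat.card_eq_fintype_card, Fintype.card_subtype_compl]
    simp
  rw [← hcard, ← Nat.card_prod]
  symm
  have hgen : ∀ (A : irreducibleEnds L b a) (α : L), aeval α (minpoly K (A : End K L)) = 0 →
      minpoly K α = minpoly K (A : End K L) ∧ K⟮α⟯ = ⊤ := by
    intro A α hα
    have hm := minpoly.eq_of_irreducible_of_monic (hsimple A).1 hα
      (minpoly.monic (LinearMap.isIntegral _))
    refine ⟨hm.symm, ?_⟩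
    rw [Field.primitive_element_iff_minpoly_natDegree_eq, ← hm, (hsimple A).2]
  choose φ hφ1 hφA using fun (A : irreducibleEnds L b a) (α : L)
    (hα : aeval α (minpoly K (A : End K L)) = 0) (v : L) (hv : v ≠ 0) =>
    exists_conj_mulLeft_eq (hgen A α hα).2 (hgen A α hα).1 hv
  refine Nat.card_eq_of_bijective (fun t => (φ t.1 t.2.1 t.2.1.2 t.2.2 t.2.2.2,
    ⟨(t.2.1 : L)⁻¹, (mem_irreducibleEnds_conj_iff (hgen t.1 _ t.2.1.2).2
      (φ t.1 t.2.1 t.2.1.2 t.2.2 t.2.2.2)).1 (by rw [hφA]; exact t.1.2)⟩)) ⟨?_, ?_⟩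
  · rintro ⟨A, ⟨α, hα⟩, ⟨v, hv⟩⟩ ⟨A', ⟨α', hα'⟩, ⟨v', hv'⟩⟩ h
    obtain ⟨h1, h2⟩ := Prod.ext_iff.1 h
    have h2 : α = α' := inv_injective (congrArg Subtype.val h2)
    subst h2
    simp only at h1
    have hA : A = A' := by
      apply Subtype.ext
      rw [← hφA A α hα v hv, h1, hφA]
    subst hA
    have hv : v = v' := by
      rw [← hφ1 A α hα v hv, h1, hφ1]
    subst hv
    rfl
  · rintro ⟨ψ, β, hβ⟩
    have htop : K⟮β⁻¹⟯ = ⊤ := by rw [adjoin_simple_inv]; exact hβ.1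
    have hA : ψ.conj (LinearMap.mulLeft K β⁻¹) ∈ irreducibleEnds L b a := by
      rw [mem_irreducibleEnds_conj_iff htop, inv_inv]; exact hβ
    have hroot : aeval β⁻¹ (minpoly K (ψ.conj (LinearMap.mulLeft K β⁻¹))) = 0 := by
      rw [minpoly_conj_mulLeft, minpoly.aeval]
    have hv : ψ 1 ≠ 0 := ψ.map_ne_zero_iff.2 one_ne_zero
    refine ⟨⟨⟨_, hA⟩, ⟨β⁻¹, hroot⟩, ⟨ψ 1, hv⟩⟩, Prod.ext ?_ (Subtype.ext (inv_inv β))⟩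
    exact conj_mulLeft_injective htop (hφA ⟨_, hA⟩ β⁻¹ hroot (ψ 1) hv)
      (hφ1 ⟨_, hA⟩ β⁻¹ hroot (ψ 1) hv)

theorem card_TSRI_eq_sum [Fintype K] :
    Nat.card (TSRI K L 3) = ∑ b : K, ∑ a : K, Nat.card (irreducibleEnds L b a) := by
  have hfin : Finite L := Module.finite_of_finite K
  have hfinE : Finite (End K L) := Finite.of_injective _ DFunLike.coe_injective
  simp only [← Nat.card_sigma]
  symm
  refine Nat.card_eq_of_bijective (fun t : Σ b : K, Σ a : K, irreducibleEnds L b a =>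
    (⟨tsrCoeff t.1 t.2.1 t.2.2, isTSR_tsrCoeff _ _ _, t.2.2.2⟩ : TSRI K L 3)) ⟨?_, ?_⟩
  · rintro ⟨b, a, A, hA⟩ ⟨b', a', A', hA'⟩ h
    have h := congrArg Subtype.val h
    have h0 : A = A' := congrFun h 0
    subst h0
    have hA0 : A ≠ 0 := by
      rintro rfl
      refine injective_of_irreducible_charpoly hA (s := ![1, 0, 0]) ?_ ?_
      · intro h; exact one_ne_zero (α := L) (by simpa using congrFun h 0)
      · rw [tsrTransition_tsrCoeff_apply]
        simp
    have h1 : b = b' := smul_left_injective K hA0 (congrFun h 1)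
    have h2 : a = a' := smul_left_injective K hA0 (congrFun h 2)
    subst h1
    subst h2
    rfl
  · rintro ⟨C, hC⟩
    obtain ⟨b, a, A, rfl⟩ := exists_eq_tsrCoeff hC
    exact ⟨⟨b, a, A, hC.2⟩, rfl⟩

theorem card_generalLinearGroup_eq {m : ℕ} (hm : finrank K L = m) :
    Nat.card (Matrix.GeneralLinearGroup (Fin m) K) = Nat.card (L ≃ₗ[K] L) := by
  refine Nat.card_congr (Equiv.trans ?_
    (LinearMap.GeneralLinearGroup.generalLinearEquiv K L).toEquiv)
  exact (Units.mapEquiv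
    (LinearMap.toMatrixAlgEquiv (finBasisOfFinrankEq K L hm)).toMulEquiv).symm.toEquiv

end Counting

/-! ### Möbius inversion over the intermediate fields -/

section Moebius

open Polynomial Module IntermediateField

/-- The cubic polynomial `X³ + bX² + aX - β`. -/
noncomputable def cubicPoly {E : Type*} [Field E] (b a β : E) : E[X] :=
  X ^ 3 + C b * X ^ 2 + C a * X - C β

section

variable {E M : Type*} [Field E] [Field M] [Algebra E M]

theorem natDegree_cubicPoly (b a β : E) : (cubicPoly b a β).natDegree = 3 := by
  unfold cubicPoly
  compute_degree!

theorem monic_cubicPoly (b a β : E) : (cubicPoly b a β).Monic := by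
  unfold cubicPoly
  monicity!

theorem aeval_cubicPoly (b a β : E) (y : M) : aeval y (cubicPoly b a β)
    = cubicVal (algebraMap E M b) (algebraMap E M a) y - algebraMap E M β := by
  simp [cubicPoly, cubicVal]

theorem irreducible_cubicPoly {b a β : E} (h : ∀ y, cubicVal b a y ≠ β) :
    Irreducible (cubicPoly b a β) := by
  refine irreducible_of_degree_le_three_of_not_isRoot (by rw [natDegree_cubicPoly]; decide) ?_
  intro y hy
  refine h y (sub_eq_zero.1 ?_)
  have := aeval_cubicPoly b a β y
  rwa [coe_aeval_eq_eval, hy.eq_zero, eq_comm] at this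

variable [FiniteDimensional E M]

/-- A value missed over `E` is still missed over an extension of degree prime to three. -/
theorem cubicVal_ne_algebraMap_of_not_dvd (h3 : ¬ 3 ∣ finrank E M) {b a β : E}
    (h : ∀ y, cubicVal b a y ≠ β) (y : M) :
    cubicVal (algebraMap E M b) (algebraMap E M a) y ≠ algebraMap E M β := by
  intro hy
  have hm := minpoly.eq_of_irreducible_of_monic (irreducible_cubicPoly h) (x := y)
    (by rw [aeval_cubicPoly, hy, sub_self]) (monic_cubicPoly b a β)
  apply h3
  rw [← natDegree_cubicPoly b a β, hm]
  exact minpoly.degree_dvd (IsIntegral.of_finite E y)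

/-- Over finite fields no value is missed over an extension of degree divisible by three. -/
theorem exists_cubicVal_eq_algebraMap_of_dvd [Finite E] (h3 : 3 ∣ finrank E M) (b a β : E) :
    ∃ y : M, cubicVal (algebraMap E M b) (algebraMap E M a) y = algebraMap E M β := by
  by_cases h : ∀ y, cubicVal b a y ≠ β
  · have hs := splits_map_of_natDegree_dvd_finrank (L := M) (irreducible_cubicPoly h)
      (by rwa [natDegree_cubicPoly])
    obtain ⟨y, hy⟩ := hs.exists_eval_eq_zero (by
      rw [degree_map, degree_eq_natDegree (monic_cubicPoly b a β).ne_zero, natDegree_cubicPoly]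
      decide)
    refine ⟨y, sub_eq_zero.1 ?_⟩
    rw [← aeval_cubicPoly, ← eval_map_algebraMap, hy]
  · push Not at h
    obtain ⟨y, hy⟩ := h
    refine ⟨algebraMap E M y, ?_⟩
    rw [← hy]
    simp [cubicVal]

end

/-- The missed values of degree dividing `k` are those missed over the subfield `F` of degree `k`,
provided that `3` does not divide `[L : F]`. -/
theorem card_filter_missedValues_eq {K L : Type*} [Field K] [Field L]
    [Algebra K L] [FiniteDimensional K L] [Fintype L] [DecidableEq L]
    {F : IntermediateField K L} [Fintype F] [DecidableEq F] {k : ℕ}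
    (hF : ∀ β : L, β ∈ F ↔ (minpoly K β).natDegree ∣ k) (h3 : ¬ 3 ∣ finrank F L) (b a : K) :
    ({β ∈ missedValues (algebraMap K L b) (algebraMap K L a) |
      (minpoly K β).natDegree ∣ k} : Finset L).card
    = (missedValues (algebraMap K F b) (algebraMap K F a)).card := by
  symm
  refine Finset.card_bij (fun β _ => (β : L)) ?_ (fun _ _ _ _ h => Subtype.ext h) ?_
  · intro β hβ
    rw [mem_missedValues] at hβ
    rw [Finset.mem_filter, mem_missedValues, ← hF]
    exact ⟨fun y => cubicVal_ne_algebraMap_of_not_dvd h3 hβ y, β.2⟩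
  · intro β hβ
    rw [Finset.mem_filter, mem_missedValues, ← hF] at hβ
    refine ⟨⟨β, hβ.2⟩, ?_, rfl⟩
    rw [mem_missedValues]
    intro y hy
    exact hβ.1 (y : L) (congrArg Subtype.val hy)

variable {K L : Type*} [Field K] [Finite K] [Field L] [Algebra K L] [FiniteDimensional K L]

/-- The subfield of degree `k` of a finite field consists of the elements whose degree
divides `k`. -/
theorem exists_intermediateField_mem_iff {k : ℕ} (hk : k ∣ finrank K L) :
    ∃ F : IntermediateField K L, finrank K F = k ∧
      ∀ β : L, β ∈ F ↔ (minpoly K β).natDegree ∣ k := by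
  have hk0 : k ≠ 0 := by
    rintro rfl
    exact finrank_pos.ne' (zero_dvd_iff.1 hk)
  have : NeZero k := ⟨hk0⟩
  have hfin : Finite L := Module.finite_of_finite K
  obtain ⟨p, hp⟩ := CharP.exists K
  have : Fact p.Prime := ⟨CharP.char_is_prime K p⟩
  obtain ⟨f⟩ := FiniteField.nonempty_algHom_of_finrank_dvd (F := K)
    (K := FiniteField.Extension K p k) (L := L) (by rwa [FiniteField.finrank_extension])
  have hrank : finrank K f.fieldRange = k :=
    (LinearEquiv.finrank_eq (AlgEquiv.ofInjectiveField f).toLinearEquiv).symm.trans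
      (FiniteField.finrank_extension K p k)
  refine ⟨f.fieldRange, hrank, fun β => ⟨fun h => ?_, fun h => ?_⟩⟩
  · rw [← hrank]
    have h1 := minpoly.degree_dvd (IsIntegral.of_finite K (⟨β, h⟩ : f.fieldRange))
    rwa [← minpoly.algHom_eq f.fieldRange.val f.fieldRange.val.injective] at h1
  · have hd := (Irreducible.natDegree_dvd_iff_dvd_X_pow_card_pow_sub_X
      (minpoly.irreducible (IsIntegral.of_finite K β))).1 h
    have h1 : β ^ Nat.card K ^ k = β := by
      have := aeval_eq_zero_of_dvd_aeval_eq_zero hd (minpoly.aeval K β)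
      simpa [sub_eq_zero] using this
    have : Fintype f.fieldRange := Fintype.ofFinite _
    obtain ⟨c, hc⟩ := (mem_range_algebraMap_iff_pow_card (K := f.fieldRange) β).2 (by
      rwa [← Nat.card_eq_fintype_card, Module.natCard_eq_pow_finrank (K := K), hrank])
    rw [← hc]
    exact c.2

theorem not_three_dvd_of_forall_cubicVal_ne {b a : K} {β : L}
    (h : ∀ y, cubicVal (algebraMap K L b) (algebraMap K L a) y ≠ β) :
    ¬ 3 ∣ finrank K L / (minpoly K β).natDegree := by
  have hfin : Finite L := Module.finite_of_finite K
  intro h3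
  rw [← adjoin.finrank (IsIntegral.of_finite K β), ← finrank_mul_finrank K K⟮β⟯ L,
    Nat.mul_div_cancel_left _ finrank_pos] at h3
  obtain ⟨y, hy⟩ := exists_cubicVal_eq_algebraMap_of_dvd h3 (algebraMap K K⟮β⟯ b)
    (algebraMap K K⟮β⟯ a) (AdjoinSimple.gen K β)
  exact h y (by simpa [← IsScalarTower.algebraMap_apply] using hy)

theorem sum_moebius_divisors (n : ℕ) :
    ∑ d ∈ n.divisors, ArithmeticFunction.moebius d = if n = 1 then 1 else 0 := by
  rw [← ArithmeticFunction.coe_mul_zeta_apply, ArithmeticFunction.moebius_mul_coe_zeta,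
    ArithmeticFunction.one_apply]

variable [Fintype L] [DecidableEq L]

/-- Möbius inversion. An element of degree `e` contributes the sum of `μ(d)` over `d ∣ m / e`,
`3 ∤ d`. The condition `3 ∤ d` is automatic because `3 ∤ m / e` for a missed value. -/
theorem card_missedGenerators_eq_sum {m : ℕ} (hm : finrank K L = m) (b a : K) :
    (Nat.card (missedGenerators L b a) : ℤ) = ∑ d ∈ m.divisors with ¬ 3 ∣ d,
      ArithmeticFunction.moebius d *
        ({β ∈ missedValues (algebraMap K L b) (algebraMap K L a) |
          (minpoly K β).natDegree ∣ m / d} : Finset L).card := by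
  classical
  have hm0 : m ≠ 0 := hm ▸ finrank_pos.ne'
  simp only [Finset.card_filter, Nat.cast_sum, Nat.cast_ite, Nat.cast_one, Nat.cast_zero,
    Finset.mul_sum, mul_ite, mul_one, mul_zero]
  rw [Finset.sum_comm]
  have hinner : ∀ β ∈ missedValues (algebraMap K L b) (algebraMap K L a),
      ∑ d ∈ m.divisors with ¬ 3 ∣ d,
        (if (minpoly K β).natDegree ∣ m / d then ArithmeticFunction.moebius d else 0)
      = if K⟮β⟯ = ⊤ then 1 else 0 := by
    intro β hβ
    rw [mem_missedValues] at hβ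
    have hn3 := not_three_dvd_of_forall_cubicVal_ne hβ
    rw [Field.primitive_element_iff_minpoly_natDegree_eq]
    have hdvd : (minpoly K β).natDegree ∣ finrank K L :=
      minpoly.degree_dvd (IsIntegral.of_finite K β)
    rw [hm] at hn3 hdvd ⊢
    generalize (minpoly K β).natDegree = e at hn3 hdvd ⊢
    obtain ⟨n, rfl⟩ := hdvd
    have he : 0 < e := Nat.pos_of_ne_zero (left_ne_zero_of_mul hm0)
    rw [Nat.mul_div_cancel_left _ he] at hn3
    rw [← Finset.sum_filter, Finset.filter_filter]
    have hset : ({d ∈ (e * n).divisors | ¬ 3 ∣ d ∧ e ∣ e * n / d} : Finset ℕ) = n.divisors := by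
      ext d
      simp only [Finset.mem_filter, Nat.mem_divisors]
      constructor
      · rintro ⟨⟨hd, -⟩, -, he'⟩
        refine ⟨?_, right_ne_zero_of_mul hm0⟩
        obtain ⟨c, hc⟩ := he'
        have h1 : e * n = d * (e * c) := by rw [← hc, Nat.mul_div_cancel' hd]
        exact ⟨c, Nat.eq_of_mul_eq_mul_left he (by rw [h1]; ring)⟩
      · rintro ⟨⟨c, rfl⟩, hn⟩
        refine ⟨⟨⟨e * c, by ring⟩, hm0⟩, fun h => hn3 (h.mul_right c), ⟨c, ?_⟩⟩
        have hd : 0 < d := Nat.pos_of_ne_zero (left_ne_zero_of_mul hn)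
        rw [show e * (d * c) = d * (e * c) by ring, Nat.mul_div_cancel_left _ hd]
    rw [hset, sum_moebius_divisors]
    congr 1
    rw [eq_iff_iff]
    constructor
    · rintro rfl; rw [mul_one]
    · intro h
      exact Nat.eq_of_mul_eq_mul_left he (by rw [mul_one]; exact h.symm)
  rw [Finset.sum_congr rfl hinner, ← Finset.sum_filter, Finset.sum_const, nsmul_eq_mul, mul_one]
  congr 1
  rw [← Nat.card_eq_finsetCard]
  refine Nat.card_congr (Equiv.subtypeEquivRight fun β => ?_)
  rw [Finset.mem_filter, mem_missedValues, and_comm]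
  rfl

/-- The total number of missed generators, in terms of numbers `S k` equal to three
times the total number of missed values over the subfield of degree `k`. -/
theorem sum_card_missedGenerators [Fintype K] {m : ℕ} (hm : finrank K L = m) (S : ℕ → ℚ)
    (hS : ∀ (F : IntermediateField K L) [Fintype F] [DecidableEq F],
      (3 * totalMissed K F : ℚ) = S (finrank K F)) :
    3 * ∑ b : K, ∑ a : K, (Nat.card (missedGenerators L b a) : ℚ)
      = ∑ d ∈ m.divisors with ¬ 3 ∣ d, (ArithmeticFunction.moebius d : ℚ) * S (m / d) := by
  classical
  have h1 : ∀ b a : K, (Nat.card (missedGenerators L b a) : ℚ)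
      = ∑ d ∈ m.divisors with ¬ 3 ∣ d, (ArithmeticFunction.moebius d : ℚ) *
        ({β ∈ missedValues (algebraMap K L b) (algebraMap K L a) |
          (minpoly K β).natDegree ∣ m / d} : Finset L).card := by
    intro b a
    exact_mod_cast card_missedGenerators_eq_sum hm b a
  simp only [h1]
  rw [Finset.sum_congr rfl fun b _ => Finset.sum_comm, Finset.sum_comm, Finset.mul_sum]
  refine Finset.sum_congr rfl fun d hd => ?_
  simp only [Finset.mem_filter, Nat.mem_divisors] at hd
  obtain ⟨⟨hdm, hm0⟩, hd3⟩ := hd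
  obtain ⟨F, hF, hmem⟩ := exists_intermediateField_mem_iff (K := K) (L := L) (k := m / d)
    (hm.symm ▸ Nat.div_dvd_of_dvd hdm)
  have hFL : finrank F L = d := by
    have h := finrank_mul_finrank K F L
    rw [hF, hm] at h
    have h' : m / d * d = m := Nat.div_mul_cancel hdm
    refine Nat.eq_of_mul_eq_mul_left (Nat.pos_of_ne_zero ?_) (h.trans h'.symm)
    intro h0
    rw [h0, zero_mul] at h'
    exact hm0 h'.symm
  rw [← hF, ← hS F, totalMissed]
  simp only [← Finset.mul_sum, hF,
    card_filter_missedValues_eq hmem (hFL.symm ▸ hd3)]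
  push_cast
  ring

end Moebius

/-! ### The number of irreducible registers of order three -/

theorem mainTheorem1 {K L : Type*} [Field K] [Finite K] [Field L] [Algebra K L]
    [FiniteDimensional K L] (q m : ℕ) (hq : Nat.card K = q) (hm : Module.finrank K L = m) :
    ((¬ ∃ k : ℕ, q = 3 ^ k) →
      (Nat.card (TSRI K L 3) : ℚ) =
        ((q : ℚ) * (Nat.card (Matrix.GeneralLinearGroup (Fin m) K) : ℚ)) /
            (3 * (m : ℚ) * ((q : ℚ) ^ m - 1)) *
          ∑ d ∈ m.divisors with ¬ 3 ∣ d,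
            (ArithmeticFunction.moebius d : ℚ) *
              ((q : ℚ) + (legendreSym 3 (q : ℤ) : ℚ) ^ (m / d)) *
              ((q : ℚ) ^ (m / d) - (legendreSym 3 (q : ℤ) : ℚ) ^ (m / d))) ∧
    ((∃ k : ℕ, q = 3 ^ k) →
      (Nat.card (TSRI K L 3) : ℚ) =
        (((q : ℚ) - 1) * (Nat.card (Matrix.GeneralLinearGroup (Fin m) K) : ℚ)) /
            (3 * (m : ℚ) * ((q : ℚ) ^ m - 1)) *
          ∑ d ∈ m.divisors with ¬ 3 ∣ d,
            (ArithmeticFunction.moebius d : ℚ) *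
              ((q : ℚ) + (3 + (-1 : ℚ) ^ (m / d)) / 2) * (q : ℚ) ^ (m / d)) := by
  classical
  have : Fintype K := Fintype.ofFinite K
  have : Finite L := Module.finite_of_finite K
  have : Fintype L := Fintype.ofFinite L
  have hqK : Fintype.card K = q := by rw [← hq, Nat.card_eq_fintype_card]
  have hq1 : 1 < q := hqK ▸ Fintype.one_lt_card
  have hm0 : m ≠ 0 := hm ▸ Module.finrank_pos.ne'
  have hcardF : ∀ (F : IntermediateField K L) [Fintype F],
      Fintype.card F = q ^ Module.finrank K F := fun F _ => by
    rw [← Nat.card_eq_fintype_card, Module.natCard_eq_pow_finrank (K := K), hq]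
  -- The double count of conjugated multiplications, summed over all coefficients.
  have hcount : (Nat.card (L ≃ₗ[K] L) : ℚ) *
      ∑ b : K, ∑ a : K, (Nat.card (missedGenerators L b a) : ℚ)
      = Nat.card (TSRI K L 3) * (m * ((q : ℚ) ^ m - 1)) := by
    have hL : ((Nat.card L - 1 : ℕ) : ℚ) = (q : ℚ) ^ m - 1 := by
      rw [Nat.cast_sub Nat.card_pos, Module.natCard_eq_pow_finrank (K := K), hq, hm]
      push_cast
      rfl
    rw [card_TSRI_eq_sum, ← hL, ← hm]
    simp only [Nat.cast_sum, Finset.mul_sum, Finset.sum_mul]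
    refine Finset.sum_congr rfl fun b _ => Finset.sum_congr rfl fun a _ => ?_
    exact_mod_cast card_mul_card_missedGenerators b a
  have hden : (m : ℚ) * ((q : ℚ) ^ m - 1) ≠ 0 := by
    refine mul_ne_zero (by exact_mod_cast hm0) (sub_ne_zero.2 ?_)
    exact_mod_cast (Nat.one_lt_pow hm0 hq1).ne'
  -- The common final step: solve the double count for the number of registers.
  have hfinal : ∀ (r : ℚ) (S : ℕ → ℚ),
      (∀ (F : IntermediateField K L) [Fintype F] [DecidableEq F],
        (3 * totalMissed K F : ℚ) = r * S (Module.finrank K F)) →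
      (Nat.card (TSRI K L 3) : ℚ)
        = (r * (Nat.card (Matrix.GeneralLinearGroup (Fin m) K) : ℚ)) /
            (3 * (m : ℚ) * ((q : ℚ) ^ m - 1)) *
          ∑ d ∈ m.divisors with ¬ 3 ∣ d, (ArithmeticFunction.moebius d : ℚ) * S (m / d) := by
    intro r S hS
    have h := sum_card_missedGenerators hm (fun k => r * S k) hS
    simp only [mul_left_comm _ r, ← Finset.mul_sum] at h
    rw [card_generalLinearGroup_eq hm, div_mul_eq_mul_div, eq_div_iff (by
      rw [mul_assoc]; exact mul_ne_zero (by norm_num) hden)]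
    linear_combination -3 * hcount + (Nat.card (L ≃ₗ[K] L) : ℚ) * h
  have hthree : (∃ k : ℕ, q = 3 ^ k) ↔ 3 ∣ Fintype.card K := by
    rw [hqK]
    constructor
    · rintro ⟨k, rfl⟩
      refine dvd_pow_self _ ?_
      rintro rfl
      simp at hq1
    · intro h
      obtain ⟨p, -, n, hp, hcard⟩ := FiniteField.card' K
      rw [hqK] at hcard
      rw [hcard] at h
      have := (Nat.prime_dvd_prime_iff_eq Nat.prime_three hp).1 (Nat.prime_three.dvd_of_dvd_pow h)
      exact ⟨n, by rw [hcard, this]⟩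
  have hthreeF : ∀ F : IntermediateField K L, (3 : F) = 0 ↔ ∃ k : ℕ, q = 3 ^ k := fun F => by
    rw [hthree, three_dvd_card_iff, ← map_ofNat (algebraMap K F) 3, map_eq_zero]
  constructor
  · intro h
    rw [hfinal q (fun k => (q + (legendreSym 3 (q : ℤ) : ℚ) ^ k) *
      ((q : ℚ) ^ k - (legendreSym 3 (q : ℤ) : ℚ) ^ k)) fun F _ _ => ?_]
    · simp only [mul_assoc]
    · have := three_mul_totalMissed_of_three_ne_zero (K := K) (F := F)
        (fun h0 => h ((hthreeF F).1 h0)) Module.finrank_pos.ne' hqK (hcardF F)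
      rw [← mul_assoc]
      exact_mod_cast this
  · intro h
    rw [hfinal (q - 1) (fun k => (q + (3 + (-1 : ℚ) ^ k) / 2) * (q : ℚ) ^ k) fun F _ _ => ?_]
    · simp only [mul_assoc]
    · rw [← mul_assoc]
      exact three_mul_totalMissed_of_three_eq_zero ((hthreeF F).2 h) hqK (hcardF F)
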